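/- Let $M$ be a smooth closed (compact, without boundary) oriented manifold of dimension $n$, and let $\omega$ be a continuous 1-form on $M$. Then $\omega$ is closed in the weak sense if and only if it is closed in the Stokes sense. Here $\omega$ is said to be *closed in the weak sense* if $$\int_M \omega\wedge d\eta = 0$$ for every smooth $(n-2)$-form $\eta$ on $M$ (a vacuous condition if $n<2$), and *closed in the Stokes sense* if $$\int_{\partial D}\omega = 0$$ for every $C^1$-immersed 2-disk $D$ in $M$ with piecewise $C^1$ boundary. A $C^1$-immersed 2-disk with piecewise $C^1$ boundary is given by a closed topological disk $D_0\subset\mathbb{R}^2$ whose boundary is parametrized by a simple closed curve $\gamma:[0,1]\to\mathbb{R}^2$ that is $C^1$ with nonvanishing velocity on each interval of a finite partition of $[0,1]$, together with a $C^1$ immersion $f:U\to M$ of an open neighbourhood $U$ of $D_0$; and $\int_{\partial D}\omega=\int_{f\circ\gamma}\omega$. -/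

import Mathlib

open Set MeasureTheory Bundle
open scoped Manifold ContDiff

noncomputable section

namespace ClosedForms

/-- The model space `ℝⁿ` with its Euclidean structure. -/
abbrev Euc (n : ℕ) : Type := EuclideanSpace ℝ (Fin n)

section Forms

variable (n : ℕ) (M : Type*) [TopologicalSpace M] [ChartedSpace (Euc n) M]

/-- A (not necessarily continuous) differential form of degree `k` on `M`. -/
abbrev DiffForm (k : ℕ) : Type _ :=
  ∀ x : M, TangentSpace (𝓡 n) x [⋀^Fin k]→L[ℝ] ℝ

/-- A (not necessarily continuous) 1-form on `M`, as a section of the cotangent bundle. -/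
abbrev OneForm : Type _ :=
  ∀ x : M, TangentSpace (𝓡 n) x →L[ℝ] ℝ

variable {n M}

/-- Continuity of a 1-form, as a section of the cotangent bundle `Hom(TM, ℝ)`. -/
def OneForm.IsContinuous [IsManifold (𝓡 n) 1 M] (α : OneForm n M) : Prop :=
  Continuous fun x : M ↦
    (TotalSpace.mk' (Euc n →L[ℝ] ℝ) x (α x) :
      TotalSpace (Euc n →L[ℝ] ℝ)
        (fun x : M ↦ TangentSpace (𝓡 n) x →L[ℝ] Bundle.Trivial M ℝ x))

/-- The coordinate expression on `e.target ⊆ ℝⁿ` of a form in the chart `e`: its pullback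
by `e.symm`. -/
def DiffForm.inChart {k : ℕ} (η : DiffForm n M k) (e : OpenPartialHomeomorph M (Euc n)) :
    Euc n → Euc n [⋀^Fin k]→L[ℝ] ℝ :=
  fun y ↦ (η (e.symm y)).compContinuousLinearMap (mfderiv (𝓡 n) (𝓡 n) e.symm y)

/-- A form is of class `C^r` if all its coordinate expressions are. -/
def DiffForm.IsContDiff {k : ℕ} (r : WithTop ℕ∞) (η : DiffForm n M k) : Prop :=
  ∀ x : M, ContDiffOn ℝ r (η.inChart (chartAt (Euc n) x)) (chartAt (Euc n) x).target

/-- The exterior derivative of a form, computed at `x` in the preferred chart at `x`. -/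
def DiffForm.d {k : ℕ} (η : DiffForm n M k) : DiffForm n M (k + 1) :=
  fun x ↦
    (extDeriv (η.inChart (chartAt (Euc n) x)) (chartAt (Euc n) x x)).compContinuousLinearMap
      (mfderiv (𝓡 n) (𝓡 n) (chartAt (Euc n) x) x)

/-- The wedge product of a covector and an alternating `k`-form:
`(ℓ ∧ θ)(v₀, …, v_k) = ∑ i, (-1)^i ℓ(v_i) θ(v₀, …, v_{i-1}, v_{i+1}, …, v_k)`. -/
def covectorWedge {E : Type*} [NormedAddCommGroup E] [NormedSpace ℝ E] {k : ℕ}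
    (ℓ : E →L[ℝ] ℝ) (θ : E [⋀^Fin k]→L[ℝ] ℝ) : E [⋀^Fin (k + 1)]→L[ℝ] ℝ :=
  ContinuousAlternatingMap.alternatizeUncurryFin (ℓ.smulRight θ)

/-- The wedge product of a 1-form and a `k`-form. -/
def OneForm.wedge {k : ℕ} (α : OneForm n M) (θ : DiffForm n M k) : DiffForm n M (k + 1) :=
  fun x ↦ covectorWedge (E := Euc n) (α x) (θ x)

variable (n M) in
/-- An orientation of `M`, given by a continuous nowhere vanishing form of top degree. -/
structure OrientationForm where
  form : DiffForm n M n
  continuous_form : form.IsContDiff 0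
  ne_zero : ∀ x, form x ≠ 0

/-- The sign `±1` of a chart `e` at the point with coordinates `y`: whether the coordinate frame
is positively or negatively oriented. -/
def OrientationForm.chartSign (o : OrientationForm n M)
    (e : OpenPartialHomeomorph M (Euc n)) (y : Euc n) : ℝ :=
  Real.sign (o.form.inChart e y (fun i ↦ EuclideanSpace.basisFun (Fin n) ℝ i))

variable (n M) in
/-- A smooth partition of unity subordinate to the charts of `M`. -/
def chartPartition [IsManifold (𝓡 n) ∞ M] [T2Space M] [CompactSpace M] :
    SmoothPartitionOfUnity M (𝓡 n) M univ :=
  Classical.choose (SmoothPartitionOfUnity.exists_isSubordinate_chartAt_source (𝓡 n) M)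

/-- The integral over the compact oriented `n`-manifold `M` of a (continuous) form whose degree
`m` equals `n`: a sum, over a partition of unity subordinate to charts, of Lebesgue integrals of
the coefficient of `dx₁ ∧ … ∧ dxₙ`, with the sign given by the orientation. -/
def OrientationForm.integral [IsManifold (𝓡 n) ∞ M] [T2Space M] [CompactSpace M]
    (o : OrientationForm n M) {m : ℕ} (hm : m = n) (μ : DiffForm n M m) : ℝ :=
  ∑ᶠ c : M, ∫ y in (chartAt (Euc n) c).target,
    chartPartition n M c ((chartAt (Euc n) c).symm y) *
      (o.chartSign (chartAt (Euc n) c) y *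
        μ.inChart (chartAt (Euc n) c) y
          (fun i ↦ EuclideanSpace.basisFun (Fin n) ℝ (Fin.cast hm i)))

/-- `α` is closed in the weak sense: `∫_M α ∧ dη = 0` for every smooth `(n-2)`-form `η`. (In
dimension `n < 2` there is no form `η` to test against.) -/
def OneForm.IsWeaklyClosed [IsManifold (𝓡 n) ∞ M] [T2Space M] [CompactSpace M]
    (o : OrientationForm n M) (α : OneForm n M) : Prop :=
  ∀ (k : ℕ) (hk : k + 1 + 1 = n) (η : DiffForm n M k),
    η.IsContDiff ∞ → o.integral hk (α.wedge η.d) = 0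

/-- The integral of a 1-form along a curve `c : [0,1] → M`. -/
def OneForm.curveIntegral (α : OneForm n M) (c : ℝ → M) : ℝ :=
  ∫ t in (0 : ℝ)..1, α (c t) (mfderiv 𝓘(ℝ, ℝ) (𝓡 n) c t (1 : ℝ))

end Forms

/-- `γ : [0,1] → ℝ²` is piecewise `C¹`: it is `C¹` with nonvanishing velocity on each closed
interval of some finite partition of `[0,1]`. -/
def IsPiecewiseC1 (γ : ℝ → Euc 2) : Prop :=
  ∃ (m : ℕ) (t : ℕ → ℝ), t 0 = 0 ∧ t m = 1 ∧ ∀ i < m,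
    t i < t (i + 1) ∧ ContDiffOn ℝ 1 γ (Icc (t i) (t (i + 1))) ∧
      ∀ s ∈ Icc (t i) (t (i + 1)), derivWithin γ (Icc (t i) (t (i + 1))) s ≠ 0

/-- A `C¹`-immersed 2-disk in `M` with piecewise `C¹` boundary: a closed topological disk
`domain ⊆ ℝ²` bounded by a piecewise `C¹` simple closed curve, with a `C¹` immersion into `M` of
an open neighbourhood of it. -/
structure ImmersedDisk (n : ℕ) (M : Type*) [TopologicalSpace M] [ChartedSpace (Euc n) M] where
  domain : Set (Euc 2)
  isDisk : Nonempty (domain ≃ₜ Metric.closedBall (0 : Euc 2) 1)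
  boundary : ℝ → Euc 2
  piecewiseC1 : IsPiecewiseC1 boundary
  closed : boundary 0 = boundary 1
  simple : InjOn boundary (Ico 0 1)
  image_boundary : boundary '' Icc 0 1 = frontier domain
  toFun : Euc 2 → M
  nhd : Set (Euc 2)
  isOpen_nhd : IsOpen nhd
  domain_subset : domain ⊆ nhd
  contMDiffOn : ContMDiffOn (𝓡 2) (𝓡 n) 1 toFun nhd
  immersive : ∀ x ∈ nhd, Function.Injective (mfderiv (𝓡 2) (𝓡 n) toFun x)

/-- `α` is closed in the Stokes sense: `∫_{∂D} α = 0` for every `C¹`-immersed 2-disk `D` with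
piecewise `C¹` boundary. -/
def OneForm.IsStokesClosed {n : ℕ} {M : Type*} [TopologicalSpace M] [ChartedSpace (Euc n) M]
    (α : OneForm n M) : Prop :=
  ∀ D : ImmersedDisk n M, α.curveIntegral (D.toFun ∘ D.boundary) = 0

end ClosedForms

end

/-! Both conditions are equivalent to local exactness (`OneForm.IsLocallyExact`): around each point,
in coordinates, the form is `dF` for a function `F`, which is then of class `C¹`. Since the form is
only continuous and the disks are only `C¹`, exterior differentiation is replaced throughout by
primitives and by distributional derivatives.

Local exactness follows from distributional closedness in charts, that is `∫ ∂_u ψ a(v) = ∫ ∂_v ψ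
a(u)` for every bump `ψ`: the mollified forms have symmetric derivative, hence have primitives on a
ball by the Poincaré lemma, and these primitives converge
(`exists_primitive_of_distribution_closed`). Weak closedness gives this identity by testing against
`ψ` times the volume form contracted with `u` and `v`. Stokes closedness gives it by testing only
elliptic disks lying in one chart. The average of translates `b(z) = ∫ ψ(y) a(y + z) dy` is
differentiable and has zero integral along small ellipses around `0`. The first-order term of such
an integral is the antisymmetric part of `Db(0)`, and `Db(0)` is minus the integral of `Dψ ⊗ a`
(`distribution_closed_of_integral_ellipse_eq_zero`).

Conversely, suppose that the form is locally `dF`. A partition of unity reduces weak closedness to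
test forms `θ` supported in one such ball, where `dF ∧ dθ = d(F dθ)` integrates to zero by Stokes.
For an immersed disk, the pulled-back form has local primitives near the domain. They glue to one
potential on the domain because it is homeomorphic to a ball
(`exists_primitive_on_topological_ball`), and the boundary integral telescopes to zero. -/

noncomputable section

namespace ClosedForms

open Filter Topology Metric

/-! ### Mollification and primitives of distributionally closed forms -/

section Primitive

variable {E : Type*} [NormedAddCommGroup E] [NormedSpace ℝ E] [FiniteDimensional ℝ E]
  [MeasurableSpace E] [BorelSpace E] {μ : Measure E} [μ.IsAddHaarMeasure]

omit [FiniteDimensional ℝ E] [MeasurableSpace E] [BorelSpace E] in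
/-- Uniform limits of locally exact forms on a ball are exact. -/
theorem exists_primitive_of_tendstoUniformlyOn {a : E → E →L[ℝ] ℝ} {A : ℕ → E → E →L[ℝ] ℝ}
    {x : E} {r : ℝ} (hA : TendstoUniformlyOn A a atTop (ball x r))
    (hex : ∀ k, ∃ F : E → ℝ, ∀ y ∈ ball x r, HasFDerivAt F (A k y) y) :
    ∃ F : E → ℝ, ∀ y ∈ ball x r, HasFDerivAt F (a y) y := by
  choose F hF using hex
  -- Normalizing at the centre fixes the constants of integration, so uniform convergence of the
  -- derivatives makes the primitives themselves uniformly Cauchy.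
  have hG : ∀ k, ∀ y ∈ ball x r, HasFDerivAt (fun z ↦ F k z - F k x) (A k y) y :=
    fun k y hy ↦ (hF k y hy).sub_const _
  have hc : UniformCauchySeqOn (fun k z ↦ F k z - F k x) atTop (ball x r) := by
    refine uniformCauchySeqOn_ball_of_fderiv (𝕜 := ℝ) hA.uniformCauchySeqOn hG ?_
    simp only [sub_self, Filter.map_const]
    exact cauchy_pure
  have hlim : ∀ y, ∃ l, y ∈ ball x r → Tendsto (fun k ↦ F k y - F k x) atTop (𝓝 l) := by
    intro y
    by_cases hy : y ∈ ball x r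
    · obtain ⟨l, hl⟩ := cauchySeq_tendsto_of_complete (hc.cauchySeq hy)
      exact ⟨l, fun _ ↦ hl⟩
    · exact ⟨0, fun h ↦ absurd h hy⟩
  choose G hGl using hlim
  exact ⟨G, fun y hy ↦ hasFDerivAt_of_tendstoUniformlyOn isOpen_ball hA hG hGl hy⟩

set_option synthInstance.maxHeartbeats 200000 in
/-- A continuous 1-form that is closed in the sense of distributions has a primitive. -/
theorem exists_primitive_of_distribution_closed {a : E → E →L[ℝ] ℝ} (ha : Continuous a)
    {x : E} {R : ℝ} (hR : 0 < R)
    (h : ∀ ψ : E → ℝ, ContDiff ℝ ∞ ψ → HasCompactSupport ψ → tsupport ψ ⊆ ball x R →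
      ∀ u v, ∫ y, fderiv ℝ ψ y u * a y v ∂μ = ∫ y, fderiv ℝ ψ y v * a y u ∂μ) :
    ∃ F : E → ℝ, ∀ y ∈ ball x (R / 2), HasFDerivAt F (a y) y := by
  -- The outer radii tend to zero and stay below `R / 2`, so a translate centred in the ball of
  -- radius `R / 2` is an admissible test function for the ball of radius `R`.
  let φ : ℕ → ContDiffBump (0 : E) := fun k ↦
    ⟨R / 2 / (k + 2) / 2, R / 2 / (k + 2), by positivity, half_lt_self (by positivity)⟩
  have hφR : ∀ k, (φ k).rOut < R / 2 := fun k ↦ by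
    change R / 2 / (k + 2) < R / 2
    exact div_lt_self (by positivity) (by linarith [(Nat.cast_nonneg k : (0 : ℝ) ≤ k)])
  have hφ0 : Tendsto (fun k ↦ (φ k).rOut) atTop (𝓝 0) := by
    change Tendsto (fun k : ℕ ↦ R / 2 / ((k : ℝ) + 2)) atTop (𝓝 0)
    exact tendsto_const_nhds.div_atTop
      (tendsto_atTop_add_const_right _ _ tendsto_natCast_atTop_atTop)
  let A : ℕ → E → E →L[ℝ] ℝ := fun k ↦
    convolution ((φ k).normed μ) a (ContinuousLinearMap.lsmul ℝ ℝ) μ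
  have hcs : ∀ k, HasCompactSupport ((φ k).normed μ) := fun k ↦ (φ k).hasCompactSupport_normed
  have hsm : ∀ k, ContDiff ℝ ∞ ((φ k).normed μ) := fun k ↦ (φ k).contDiff_normed
  let L : ℝ →L[ℝ] (E →L[ℝ] ℝ) →L[ℝ] E →L[ℝ] ℝ := ContinuousLinearMap.lsmul ℝ ℝ
  let B : ℕ → E → E →L[ℝ] E →L[ℝ] ℝ := fun k ↦
    convolution (𝕜 := ℝ) (fderiv ℝ ((φ k).normed μ)) a (L.precompL E) μ
  have hder : ∀ k y, HasFDerivAt (A k) (B k y) y := fun k y ↦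
    (hcs k).hasFDerivAt_convolution_left L ((hsm k).of_le (by simp))
      ha.locallyIntegrable y
  -- The derivative of the convolution falls on the smooth factor. After the substitution `t ↦ y -
  -- t` it is minus the pairing of `a` with the test function `φ (y - ·)`, so the hypothesis becomes
  -- symmetry of the derivative.
  have hform : ∀ k y u v, fderiv ℝ (A k) y u v =
      -∫ t, fderiv ℝ (fun s ↦ (φ k).normed μ (y - s)) t u * a t v ∂μ := by
    intro k y u v
    have hint : ConvolutionExistsAt (𝕜 := ℝ) (F := E →L[ℝ] E →L[ℝ] ℝ)
        (fderiv ℝ ((φ k).normed μ)) a y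
        (L.precompL E) μ :=
      ((hcs k).fderiv ℝ).convolutionExists_left _
        ((hsm k).continuous_fderiv (by simp)) ha.locallyIntegrable y
    have hB : B k y u v = ∫ t, fderiv ℝ ((φ k).normed μ) t u * a (y - t) v ∂μ := by
      change (∫ t, (L.precompL E) (fderiv ℝ ((φ k).normed μ) t)
        (a (y - t)) ∂μ) u v = _
      rw [ContinuousLinearMap.integral_apply hint,
        ContinuousLinearMap.integral_apply (hint.apply_continuousLinearMap u)]
      simp [L]
    rw [(hder k y).fderiv, hB, ← integral_sub_left_eq_self _ μ y, ← integral_neg]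
    refine integral_congr_ae (Eventually.of_forall fun t ↦ ?_)
    have hd : HasFDerivAt (fun s ↦ (φ k).normed μ (y - s))
        (-(fderiv ℝ ((φ k).normed μ) (y - t))) t := by
      have h1 := (((hsm k).differentiable (by simp)) (y - t)).hasFDerivAt
      simpa using! h1.comp t ((hasFDerivAt_id t).const_sub y)
    simp only [hd.fderiv, sub_sub_cancel]
    simp
  refine exists_primitive_of_tendstoUniformlyOn (A := A) ?_ ?_
  · rw [Metric.tendstoUniformlyOn_iff]
    intro ε hε
    have huc := (isCompact_closedBall x R).uniformContinuousOn_of_continuous ha.continuousOn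
    obtain ⟨δ, hδ, H⟩ := Metric.uniformContinuousOn_iff.1 huc (ε / 2) (half_pos hε)
    filter_upwards [hφ0.eventually (gt_mem_nhds hδ)] with k hk y hy
    rw [dist_comm]
    refine lt_of_le_of_lt ((φ k).dist_normed_convolution_le ha.aestronglyMeasurable
      fun z hz ↦ (H z ?_ y ?_ ?_).le) (half_lt_self hε)
    · have h1 := dist_triangle z y x
      have h2 := hφR k
      rw [mem_ball] at hz hy
      rw [mem_closedBall]; linarith
    · rw [mem_ball] at hy
      rw [mem_closedBall]; linarith
    · exact lt_trans hz hk
  · intro k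
    -- Poincaré lemma on a convex set.
    refine (convex_ball x (R / 2)).exists_forall_hasFDerivAt_of_fderiv_symmetric isOpen_ball
      (fun y _ ↦ (hder k y).differentiableAt.differentiableWithinAt) fun y hy u v ↦ ?_
    rw [hform, hform, h]
    · exact (hsm k).comp (contDiff_const.sub contDiff_id)
    · exact (hcs k).comp_homeomorph (Homeomorph.subLeft y)
    · have : tsupport (fun s ↦ (φ k).normed μ (y - s)) ⊆ closedBall y (φ k).rOut := by
        refine closure_minimal (fun s hs ↦ ?_) isClosed_closedBall
        have : y - s ∈ Function.support ((φ k).normed μ) := hs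
        rw [(φ k).support_normed_eq, mem_ball_zero_iff] at this
        rw [mem_closedBall, dist_comm, dist_eq_norm]
        exact this.le
      refine this.trans fun s hs ↦ ?_
      have h1 := dist_triangle s y x
      have h2 := hφR k
      rw [mem_closedBall] at hs
      rw [mem_ball] at hy ⊢
      linarith

end Primitive

/-- A function on pairs of points of a ball that is additive at a small scale is, at a small
scale, the increment of a function. -/
theorem exists_increment_of_local_cocycle {E : Type*} [NormedAddCommGroup E] [NormedSpace ℝ E]
    {w : E → E → ℝ} {δ : ℝ} (hδ : 0 < δ)
    (hw : ∀ p ∈ closedBall (0 : E) 1, ∀ q ∈ closedBall (0 : E) 1, ∀ r ∈ closedBall (0 : E) 1,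
      dist p q < δ → dist q r < δ → dist p r < δ → w p q + w q r = w p r) :
    ∃ u : E → ℝ, ∀ p ∈ closedBall (0 : E) 1, ∀ q ∈ closedBall (0 : E) 1, dist p q < δ / 2 →
      u q - u p = w p q := by
  obtain ⟨N, hN⟩ := exists_nat_gt (2 / δ)
  have hN0 : (0 : ℝ) < N := lt_trans (by positivity) hN
  have hNδ : 1 / (N : ℝ) < δ / 2 := by
    rw [div_lt_iff₀ hδ] at hN
    rw [div_lt_div_iff₀ hN0 two_pos]
    linarith
  let s : ℕ → ℝ := fun i ↦ i / N
  have hs0 : ∀ i, 0 ≤ s i := fun i ↦ by positivity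
  have hs1 : ∀ i ≤ N, s i ≤ 1 := fun i hi ↦ by
    rw [div_le_one hN0]; exact_mod_cast hi
  have hmem : ∀ p ∈ closedBall (0 : E) 1, ∀ i ≤ N, s i • p ∈ closedBall (0 : E) 1 := by
    intro p hp i hi
    rw [mem_closedBall_zero_iff] at hp ⊢
    rw [norm_smul, Real.norm_of_nonneg (hs0 i)]
    exact mul_le_one₀ (hs1 i hi) (norm_nonneg _) hp
  have hstep : ∀ p ∈ closedBall (0 : E) 1, ∀ i, dist (s i • p) (s (i + 1) • p) < δ / 2 := by
    intro p hp i
    rw [mem_closedBall_zero_iff] at hp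
    rw [dist_comm, dist_eq_norm, ← sub_smul, norm_smul]
    have : s (i + 1) - s i = 1 / N := by simp only [s]; push_cast; ring
    rw [this, Real.norm_of_nonneg (by positivity)]
    exact lt_of_le_of_lt (mul_le_of_le_one_right (by positivity) hp) hNδ
  have hclose : ∀ p q : E, dist p q < δ / 2 → ∀ i ≤ N, dist (s i • p) (s i • q) < δ / 2 := by
    intro p q hpq i hi
    rw [dist_smul₀, Real.norm_of_nonneg (hs0 i)]
    exact lt_of_le_of_lt (mul_le_of_le_one_left dist_nonneg (hs1 i hi)) hpq
  have hself : ∀ p ∈ closedBall (0 : E) 1, w p p = 0 := fun p hp ↦ by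
    have := hw p hp p hp p hp (by simpa) (by simpa) (by simpa)
    linarith
  -- The value at `x` is the sum of `w` along `N` equal steps of the radius from `0` to `x`, each
  -- shorter than `δ / 2`.
  refine ⟨fun x ↦ ∑ i ∈ Finset.range N, w (s i • x) (s (i + 1) • x), fun p hp q hq hpq ↦ ?_⟩
  -- Climb the ladder between the radii to `p` and to `q`. Each cell is cut by a diagonal into two
  -- triangles where the cocycle identity applies; sides below `δ / 2` keep the diagonal below `δ`.
  have key : ∀ k ≤ N, ∑ i ∈ Finset.range k, w (s i • q) (s (i + 1) • q) -
      ∑ i ∈ Finset.range k, w (s i • p) (s (i + 1) • p) = w (s k • p) (s k • q) := by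
    intro k
    induction k with
    | zero => intro _; simpa [s] using (hself 0 (by simp)).symm
    | succ k ih =>
      intro hk
      have hk' : k ≤ N := by omega
      rw [Finset.sum_range_succ, Finset.sum_range_succ]
      have h1 := hw _ (hmem p hp k hk') _ (hmem p hp (k + 1) hk) _ (hmem q hq (k + 1) hk)
        (by linarith [hstep p hp k]) (by linarith [hclose p q hpq (k + 1) hk])
        (by linarith [hstep p hp k, hclose p q hpq (k + 1) hk,
          dist_triangle (s k • p) (s (k + 1) • p) (s (k + 1) • q)])
      have h2 := hw _ (hmem p hp k hk') _ (hmem q hq k hk') _ (hmem q hq (k + 1) hk)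
        (by linarith [hclose p q hpq k hk']) (by linarith [hstep q hq k])
        (by linarith [hstep p hp k, hclose p q hpq (k + 1) hk,
          dist_triangle (s k • p) (s (k + 1) • p) (s (k + 1) • q)])
      linarith [ih hk']
  have := key N le_rfl
  have hsN : s N = 1 := div_self hN0.ne'
  simpa [hsN] using this

/-! ### Small ellipses detect the antisymmetric part of the derivative -/

section Circles

open Real

variable {E : Type*} [NormedAddCommGroup E] [NormedSpace ℝ E]

/-- The parametrized ellipse `cos (2πt) v + sin (2πt) w`. -/
def ellipse (v w : E) (t : ℝ) : E := cos (2 * π * t) • v + sin (2 * π * t) • w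

/-- The direction `-sin (2πt) v + cos (2πt) w` of the velocity of an ellipse. -/
def ellipseDir (v w : E) (t : ℝ) : E := -sin (2 * π * t) • v + cos (2 * π * t) • w

theorem continuous_ellipse (v w : E) : Continuous (ellipse v w) := by
  unfold ellipse; fun_prop

theorem continuous_ellipseDir (v w : E) : Continuous (ellipseDir v w) := by
  unfold ellipseDir; fun_prop

theorem norm_ellipse_le (v w : E) (t : ℝ) : ‖ellipse v w t‖ ≤ ‖v‖ + ‖w‖ := by
  refine (norm_add_le _ _).trans (add_le_add ?_ ?_) <;> rw [norm_smul]
  · exact mul_le_of_le_one_left (norm_nonneg _) (abs_cos_le_one _)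
  · exact mul_le_of_le_one_left (norm_nonneg _) (abs_sin_le_one _)

theorem norm_ellipseDir_le (v w : E) (t : ℝ) : ‖ellipseDir v w t‖ ≤ ‖v‖ + ‖w‖ := by
  refine (norm_add_le _ _).trans (add_le_add ?_ ?_) <;> rw [norm_smul]
  · rw [norm_neg]; exact mul_le_of_le_one_left (norm_nonneg _) (abs_sin_le_one _)
  · exact mul_le_of_le_one_left (norm_nonneg _) (abs_cos_le_one _)

theorem ellipse_smul (r : ℝ) (v w : E) (t : ℝ) : ellipse (r • v) (r • w) t = r • ellipse v w t := by
  simp only [ellipse, smul_add, smul_comm r]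

theorem ellipseDir_smul (r : ℝ) (v w : E) (t : ℝ) :
    ellipseDir (r • v) (r • w) t = r • ellipseDir v w t := by
  simp only [ellipseDir, smul_add, smul_comm r]

theorem integral_comp_two_pi (f : ℝ → ℝ) :
    ∫ t in (0 : ℝ)..1, f (2 * π * t) = (2 * π)⁻¹ * ∫ t in (0 : ℝ)..(2 * π), f t := by
  rw [intervalIntegral.integral_comp_mul_left _ (by positivity)]
  simp

theorem integral_clm_ellipseDir (ℓ : E →L[ℝ] ℝ) (v w : E) :
    ∫ t in (0 : ℝ)..1, ℓ (ellipseDir v w t) = 0 := by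
  have h1 := integral_comp_two_pi (fun s ↦ -sin s * ℓ v + cos s * ℓ w)
  simp only [ellipseDir, map_add, map_smul, smul_eq_mul]
  rw [h1, intervalIntegral.integral_add (by apply Continuous.intervalIntegrable; fun_prop)
    (by apply Continuous.intervalIntegrable; fun_prop)]
  simp

/-- The diagonal terms carry `sin * cos`, of mean zero, while `cos ^ 2` and `sin ^ 2` have mean `1 /
2`; only the antisymmetric part of `B` survives. -/
theorem integral_bilin_ellipse (B : E →L[ℝ] E →L[ℝ] ℝ) (v w : E) :
    ∫ t in (0 : ℝ)..1, B (ellipse v w t) (ellipseDir v w t) = (B v w - B w v) / 2 := by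
  have h1 := integral_comp_two_pi
    (fun s ↦ (sin s * cos s) * (B w w - B v v) + (cos s ^ 2 * B v w - sin s ^ 2 * B w v))
  have h2 : ∀ t, B (ellipse v w t) (ellipseDir v w t) =
      (sin (2 * π * t) * cos (2 * π * t)) * (B w w - B v v) +
        (cos (2 * π * t) ^ 2 * B v w - sin (2 * π * t) ^ 2 * B w v) := by
    intro t
    simp only [ellipse, ellipseDir, map_add, map_smul, smul_eq_mul, add_apply,
      smul_apply]
    ring
  simp only [h2]
  rw [h1, intervalIntegral.integral_add (by apply Continuous.intervalIntegrable; fun_prop)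
    (by apply Continuous.intervalIntegrable; fun_prop),
    intervalIntegral.integral_sub (by apply Continuous.intervalIntegrable; fun_prop)
    (by apply Continuous.intervalIntegrable; fun_prop)]
  simp only [intervalIntegral.integral_mul_const, integral_sin_mul_cos₁, integral_cos_sq,
    integral_sin_sq]
  simp
  field_simp

/-- If the integrals of a 1-form along the circles around a point vanish, then its derivative
at that point is symmetric. -/
theorem symmetric_of_integral_ellipse_eq_zero {b : E → E →L[ℝ] ℝ} (hb : Continuous b)
    {B : E →L[ℝ] E →L[ℝ] ℝ} (hB : HasFDerivAt b B 0) {v w : E}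
    (h : ∀ᶠ r : ℝ in 𝓝[>] 0, ∫ t in (0 : ℝ)..1, b (r • ellipse v w t) (ellipseDir v w t) = 0) :
    B v w = B w v := by
  set C := ‖v‖ + ‖w‖ with hC
  have hC0 : 0 ≤ C := by positivity
  -- Expand `b` to first order on the ellipse scaled by `r`: the constant term integrates to zero
  -- and the linear one to `r (B v w - B w v) / 2`. As the whole integral vanishes, that term is
  -- bounded by the remainder `ε (r C) C`, and `r` cancels.
  have key : ∀ ε > 0, |(B v w - B w v) / 2| ≤ ε * C * C := by
    intro ε hε
    have h1 := hB.isLittleO.def hε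
    simp only [sub_zero] at h1
    obtain ⟨δ, hδ, H⟩ := Metric.eventually_nhds_iff.1 h1
    have h2 : ∀ᶠ r : ℝ in 𝓝[>] 0, r * C < δ := by
      have : Tendsto (fun r : ℝ ↦ r * C) (𝓝[>] 0) (𝓝 (0 * C)) :=
        (tendsto_id.mul_const C).mono_left nhdsWithin_le_nhds
      rw [zero_mul] at this
      exact this.eventually (gt_mem_nhds hδ)
    obtain ⟨r, ⟨hr, hrC⟩, hr0⟩ := ((h.and h2).and self_mem_nhdsWithin).exists
    have hi1 : IntervalIntegrable (fun t ↦ b (r • ellipse v w t) (ellipseDir v w t)) volume 0 1 :=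
      ((hb.comp ((continuous_ellipse v w).const_smul r)).clm_apply
        (continuous_ellipseDir v w)).intervalIntegrable _ _
    have hi2 : IntervalIntegrable (fun t ↦ b 0 (ellipseDir v w t)) volume 0 1 :=
      ((b 0).continuous.comp (continuous_ellipseDir v w)).intervalIntegrable _ _
    have hi3 : IntervalIntegrable (fun t ↦ r * B (ellipse v w t) (ellipseDir v w t)) volume 0 1 :=
      (continuous_const.mul ((B.continuous.comp (continuous_ellipse v w)).clm_apply
        (continuous_ellipseDir v w))).intervalIntegrable _ _
    have h3 : ∫ t in (0 : ℝ)..1, (b (r • ellipse v w t) (ellipseDir v w t) -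
        b 0 (ellipseDir v w t) - r * B (ellipse v w t) (ellipseDir v w t)) =
        -(r * ((B v w - B w v) / 2)) := by
      rw [intervalIntegral.integral_sub (hi1.sub hi2) hi3, intervalIntegral.integral_sub hi1 hi2,
        hr, integral_clm_ellipseDir, intervalIntegral.integral_const_mul, integral_bilin_ellipse]
      ring
    have h4 : ‖∫ t in (0 : ℝ)..1, (b (r • ellipse v w t) (ellipseDir v w t) -
        b 0 (ellipseDir v w t) - r * B (ellipse v w t) (ellipseDir v w t))‖ ≤
        (ε * (r * C) * C) * |1 - 0| := by
      refine intervalIntegral.norm_integral_le_of_norm_le_const fun t _ ↦ ?_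
      have h5 : b (r • ellipse v w t) (ellipseDir v w t) - b 0 (ellipseDir v w t) -
          r * B (ellipse v w t) (ellipseDir v w t) =
          (b (r • ellipse v w t) - b 0 - B (r • ellipse v w t)) (ellipseDir v w t) := by
        simp
      have h6 : ‖r • ellipse v w t‖ ≤ r * C := by
        rw [norm_smul, Real.norm_of_nonneg hr0.le]
        exact mul_le_mul_of_nonneg_left (norm_ellipse_le v w t) hr0.le
      rw [h5]
      refine (ContinuousLinearMap.le_opNorm _ _).trans ?_
      have h7 := H (y := r • ellipse v w t) (by rw [dist_zero_right]; exact h6.trans_lt hrC)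
      gcongr
      · exact h7.trans (by gcongr)
      · exact norm_ellipseDir_le v w t
    rw [h3, norm_neg, norm_mul, Real.norm_of_nonneg hr0.le, Real.norm_eq_abs] at h4
    simp only [sub_zero, abs_one, mul_one] at h4
    have h8 : r * |(B v w - B w v) / 2| ≤ r * (ε * C * C) := by linarith
    exact le_of_mul_le_mul_left h8 hr0
  have h0 : |(B v w - B w v) / 2| ≤ 0 := by
    refine le_of_forall_pos_le_add fun ε hε ↦ ?_
    -- The `+ 1` covers `C = 0`.
    refine (key (ε / (C * C + 1)) (by positivity)).trans ?_
    rw [zero_add, mul_assoc, div_mul_eq_mul_div, div_le_iff₀ (by positivity)]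
    nlinarith
  have := abs_nonpos_iff.1 h0
  linarith

variable [FiniteDimensional ℝ E] [MeasurableSpace E] [BorelSpace E] {μ : Measure E}
  [μ.IsAddHaarMeasure]

set_option synthInstance.maxHeartbeats 200000 in
/-- A continuous 1-form whose integrals along small ellipses vanish is closed in the sense of
distributions. -/
theorem distribution_closed_of_integral_ellipse_eq_zero {a : E → E →L[ℝ] ℝ} (ha : Continuous a)
    {x : E} {R : ℝ}
    (h : ∀ y v w : E, LinearIndependent ℝ ![v, w] → closedBall y (‖v‖ + ‖w‖) ⊆ ball x R →
      ∫ t in (0 : ℝ)..1, a (y + ellipse v w t) (ellipseDir v w t) = 0)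
    {ψ : E → ℝ} (hψ : ContDiff ℝ ∞ ψ) (hψc : HasCompactSupport ψ) (hψs : tsupport ψ ⊆ ball x R)
    (v w : E) :
    ∫ y, fderiv ℝ ψ y v * a y w ∂μ = ∫ y, fderiv ℝ ψ y w * a y v ∂μ := by
  -- Ellipses on dependent vectors are degenerate and not covered by `h`, but then the identity is
  -- trivial by bilinearity.
  by_cases hvw : LinearIndependent ℝ ![v, w]
  swap
  · rw [LinearIndependent.pair_iff] at hvw
    push Not at hvw
    obtain ⟨s, t, hst, hne⟩ := hvw
    by_cases hs : s = 0
    · have ht := hne hs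
      have hw : w = 0 := by simpa [hs, ht] using hst
      simp [hw]
    · have hv : v = (-(s⁻¹ * t)) • w := by
        have : s • v = -(t • w) := eq_neg_of_add_eq_zero_left hst
        rw [neg_smul, mul_smul, ← smul_neg, ← this, smul_smul, inv_mul_cancel₀ hs, one_smul]
      rw [hv]
      simp only [map_smul, smul_eq_mul]
      congr 1 with y
      ring
  let L : (E →L[ℝ] ℝ) →L[ℝ] ℝ →L[ℝ] E →L[ℝ] ℝ := (ContinuousLinearMap.lsmul ℝ ℝ).flip
  -- The reflection turns convolution into the average of translates `b z = ∫ ψ y * a (y + z)`,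
  -- which is differentiable although `a` is only continuous.
  let ψ' : E → ℝ := fun z ↦ ψ (-z)
  have hψ' : ContDiff ℝ ∞ ψ' := hψ.comp contDiff_neg
  have hψc' : HasCompactSupport ψ' := hψc.comp_homeomorph (Homeomorph.neg E)
  let b : E → E →L[ℝ] ℝ := convolution (𝕜 := ℝ) a ψ' L μ
  let D : E → E →L[ℝ] E →L[ℝ] ℝ := convolution (𝕜 := ℝ) a (fderiv ℝ ψ') (L.precompR E) μ
  have hder : ∀ z, HasFDerivAt b (D z) z := fun z ↦
    hψc'.hasFDerivAt_convolution_right L ha.locallyIntegrable (hψ'.of_le (by simp)) z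
  have hbc : Continuous b := continuous_iff_continuousAt.2 fun z ↦ (hder z).continuousAt
  have hψd : ∀ z, fderiv ℝ ψ' z = -fderiv ℝ ψ (-z) := fun z ↦ by
    have h1 := (hψ.differentiable (by simp) (-z)).hasFDerivAt
    have h2 : HasFDerivAt ψ' (-fderiv ℝ ψ (-z)) z := by
      simpa using! h1.comp z (hasFDerivAt_id z).neg
    exact h2.fderiv
  have hD : ∀ u e, D 0 u e = -∫ y, fderiv ℝ ψ y u * a y e ∂μ := by
    intro u e
    have hint : ConvolutionExistsAt (𝕜 := ℝ) (F := E →L[ℝ] E →L[ℝ] ℝ) a (fderiv ℝ ψ') 0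
        (L.precompR E) μ :=
      (hψc'.fderiv ℝ).convolutionExists_right _ ha.locallyIntegrable
        (hψ'.continuous_fderiv (by simp)) 0
    change (∫ t, (L.precompR E) (a t) (fderiv ℝ ψ' (0 - t)) ∂μ) u e = _
    rw [ContinuousLinearMap.integral_apply hint,
        ContinuousLinearMap.integral_apply (hint.apply_continuousLinearMap u), ← integral_neg]
    simp [L, hψd]
  have hb : ∀ z e, b z e = ∫ y, ψ y * a (y + z) e ∂μ := by
    intro z e
    have hint : ConvolutionExistsAt (𝕜 := ℝ) a ψ' z L μ :=
      hψc'.convolutionExists_right _ ha.locallyIntegrable hψ'.continuous z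
    change (∫ t, L (a t) (ψ' (z - t)) ∂μ) e = _
    rw [ContinuousLinearMap.integral_apply hint,
      ← integral_add_right_eq_self (fun t ↦ (L (a t) (ψ' (z - t))) e) z]
    simp [L, ψ']
  -- Fubini moves the ellipse integral of `b` inside the average over `y`. For small `r` the
  -- ellipses centred in the support of `ψ` stay in the ball, so each inner integral is zero by `h`.
  have hsymm : D 0 v w = D 0 w v := by
    refine symmetric_of_integral_ellipse_eq_zero hbc (hder 0) ?_
    obtain ⟨δ, hδ, hδs⟩ := hψc.isCompact.exists_cthickening_subset_open isOpen_ball hψs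
    have h2 : ∀ᶠ r : ℝ in 𝓝[>] 0, r * (‖v‖ + ‖w‖) < δ := by
      have : Tendsto (fun r : ℝ ↦ r * (‖v‖ + ‖w‖)) (𝓝[>] 0) (𝓝 (0 * (‖v‖ + ‖w‖))) :=
        (tendsto_id.mul_const _).mono_left nhdsWithin_le_nhds
      rw [zero_mul] at this
      exact this.eventually (gt_mem_nhds hδ)
    filter_upwards [h2, self_mem_nhdsWithin] with r hr hr0
    rw [mem_Ioi] at hr0
    simp only [hb]
    have hcont : Continuous (fun p : ℝ × E ↦
        ψ p.2 * a (p.2 + r • ellipse v w p.1) (ellipseDir v w p.1)) :=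
      (hψ.continuous.comp continuous_snd).mul ((ha.comp (continuous_snd.add
        (((continuous_ellipse v w).comp continuous_fst).const_smul r))).clm_apply
          ((continuous_ellipseDir v w).comp continuous_fst))
    have hI : IntegrableOn (fun p : ℝ × E ↦
        ψ p.2 * a (p.2 + r • ellipse v w p.1) (ellipseDir v w p.1)) (Ioc 0 1 ×ˢ univ)
        (volume.prod μ) := by
      have h1 := (hcont.continuousOn (s := Icc 0 1 ×ˢ tsupport ψ)).integrableOn_compact
        (μ := volume.prod μ) (isCompact_Icc.prod hψc.isCompact)
      refine h1.of_forall_sdiff_eq_zero (measurableSet_Ioc.prod MeasurableSet.univ) fun p hp ↦ ?_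
      have : p.2 ∉ tsupport ψ := fun h' ↦ hp.2 ⟨Ioc_subset_Icc_self hp.1.1, h'⟩
      simp [image_eq_zero_of_notMem_tsupport this]
    rw [intervalIntegral.integral_of_le zero_le_one, integral_integral_swap]
    swap
    · rw [IntegrableOn, ← Measure.prod_restrict, Measure.restrict_univ] at hI
      exact hI
    refine integral_eq_zero_of_ae (Eventually.of_forall fun y ↦ ?_)
    simp only [Pi.zero_apply]
    rw [integral_const_mul]
    by_cases hy : y ∈ tsupport ψ
    · have h3 := h y (r • v) (r • w) ?_ ?_
      · rw [intervalIntegral.integral_of_le zero_le_one] at h3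
        simp only [ellipse_smul, ellipseDir_smul, map_smul, smul_eq_mul] at h3
        rw [integral_const_mul] at h3
        rw [(mul_eq_zero.1 h3).resolve_left hr0.ne', mul_zero]
      · rw [LinearIndependent.pair_iff] at hvw ⊢
        intro s t hst
        have := hvw (s * r) (t * r) (by simpa [mul_smul] using hst)
        simpa [hr0.ne'] using this
      · have : ‖r • v‖ + ‖r • w‖ ≤ δ := by
          rw [norm_smul, norm_smul, Real.norm_of_nonneg hr0.le]; linarith
        exact ((closedBall_subset_closedBall this).trans (closedBall_subset_cthickening hy δ)).trans
          hδs
    · rw [image_eq_zero_of_notMem_tsupport hy, zero_mul]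
  rw [hD, hD] at hsymm
  linarith

end Circles

/-! ### Wedge with a covector, contraction, and forms of top degree -/

section Algebra

variable {E : Type*} [NormedAddCommGroup E] [NormedSpace ℝ E] {k : ℕ}

theorem covectorWedge_apply (ℓ : E →L[ℝ] ℝ) (θ : E [⋀^Fin k]→L[ℝ] ℝ) (v : Fin (k + 1) → E) :
    covectorWedge ℓ θ v = ∑ i : Fin (k + 1), (-1) ^ (i : ℕ) * (ℓ (v i) * θ (i.removeNth v)) := by
  simp [covectorWedge, ContinuousAlternatingMap.alternatizeUncurryFin_apply]

theorem covectorWedge_add (ℓ : E →L[ℝ] ℝ) (θ θ' : E [⋀^Fin k]→L[ℝ] ℝ) :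
    covectorWedge ℓ (θ + θ') = covectorWedge ℓ θ + covectorWedge ℓ θ' := by
  ext v
  simp [covectorWedge_apply, mul_add, Finset.sum_add_distrib]

theorem covectorWedge_smul (ℓ : E →L[ℝ] ℝ) (r : ℝ) (θ : E [⋀^Fin k]→L[ℝ] ℝ) :
    covectorWedge ℓ (r • θ) = r • covectorWedge ℓ θ := by
  ext v
  simp only [covectorWedge_apply, ContinuousAlternatingMap.smul_apply, smul_eq_mul, Finset.mul_sum]
  exact Finset.sum_congr rfl fun i _ ↦ by ring

/-- The wedge product with a covector, as a linear map. -/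
def covectorWedgeLM (ℓ : E →L[ℝ] ℝ) : E [⋀^Fin k]→L[ℝ] ℝ →ₗ[ℝ] E [⋀^Fin (k + 1)]→L[ℝ] ℝ where
  toFun := covectorWedge ℓ
  map_add' := covectorWedge_add ℓ
  map_smul' := covectorWedge_smul ℓ

theorem covectorWedge_comp {E' : Type*} [NormedAddCommGroup E'] [NormedSpace ℝ E']
    (ℓ : E →L[ℝ] ℝ) (θ : E [⋀^Fin k]→L[ℝ] ℝ) (L : E' →L[ℝ] E) :
    (covectorWedge ℓ θ).compContinuousLinearMap L =
      covectorWedge (ℓ.comp L) (θ.compContinuousLinearMap L) := by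
  ext v
  simp only [ContinuousAlternatingMap.compContinuousLinearMap_apply, covectorWedge_apply]
  rfl

/-- Antiderivation rule for contraction: in the expansion of `ℓ ∧ σ` with `q` in the first slot, the
first term is `ℓ q • σ`, and the others have their sign shifted by one. -/
theorem covectorWedge_curryLeft (ℓ : E →L[ℝ] ℝ) (σ : E [⋀^Fin (k + 1)]→L[ℝ] ℝ) (q : E) :
    covectorWedge ℓ (σ.curryLeft q) = ℓ q • σ - (covectorWedge ℓ σ).curryLeft q := by
  ext v
  simp only [ContinuousAlternatingMap.sub_apply, ContinuousAlternatingMap.smul_apply,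
    ContinuousAlternatingMap.curryLeft_apply_apply, covectorWedge_apply, smul_eq_mul]
  rw [Fin.sum_univ_succ (n := k + 1)]
  have h0 : (0 : Fin (k + 2)).removeNth (Matrix.vecCons q v) = v := by
    ext i; simp [Fin.removeNth]
  have h1 : ∀ i : Fin (k + 1), i.succ.removeNth (Matrix.vecCons q v) =
      Matrix.vecCons q (i.removeNth v) := by
    intro i
    ext j
    refine Fin.cases ?_ (fun j ↦ ?_) j <;> simp [Fin.removeNth]
  simp only [h0, h1, Matrix.cons_val_zero, Matrix.cons_val_succ, Fin.val_zero, Fin.val_succ,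
    pow_zero, one_mul, pow_succ]
  rw [sub_add_eq_sub_sub, sub_self, zero_sub, ← Finset.sum_neg_distrib]
  exact Finset.sum_congr rfl fun i _ ↦ by ring

theorem eq_zero_of_finrank_lt [FiniteDimensional ℝ E] (hk : Module.finrank ℝ E < k)
    (σ : E [⋀^Fin k]→L[ℝ] ℝ) : σ = 0 := by
  ext v
  refine σ.toAlternatingMap.map_linearDependent v fun h ↦ ?_
  have := h.fintype_card_le_finrank
  simp at this
  omega

/-- Wedging a covector into a top-degree form gives zero, so the antiderivation rule yields `m ∧ ι_p
σ = m p • σ`; using it twice gives the claim. Contracted volume forms thus let a test form single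
out any two directions. -/
theorem covectorWedge_covectorWedge_curryLeft [FiniteDimensional ℝ E]
    (hk : Module.finrank ℝ E = k + 2) (σ : E [⋀^Fin (k + 2)]→L[ℝ] ℝ) (ℓ m : E →L[ℝ] ℝ) (p q : E) :
    covectorWedge ℓ (covectorWedge m ((σ.curryLeft p).curryLeft q)) =
      (m q * ℓ p - m p * ℓ q) • σ := by
  have h0 : ∀ (m : E →L[ℝ] ℝ), covectorWedge m σ = 0 := fun m ↦ eq_zero_of_finrank_lt (by omega) _
  have h1 : ∀ (m : E →L[ℝ] ℝ) p, covectorWedge m (σ.curryLeft p) = m p • σ := fun m p ↦ by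
    rw [covectorWedge_curryLeft, h0]; simp
  have h2 : (m p • σ).curryLeft q = m p • σ.curryLeft q := by ext; simp
  rw [covectorWedge_curryLeft, h1, h2, sub_eq_add_neg,
    show -(m p • σ.curryLeft q) = (-m p) • σ.curryLeft q by ext; simp, covectorWedge_add,
    covectorWedge_smul, covectorWedge_smul, h1, h1, smul_smul, smul_smul, ← add_smul]
  congr 1
  ring

theorem exists_volume (n : ℕ) : ∃ σ : Euc n [⋀^Fin n]→L[ℝ] ℝ,
    σ (fun i ↦ EuclideanSpace.basisFun (Fin n) ℝ i) = 1 := by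
  let b := (EuclideanSpace.basisFun (Fin n) ℝ).toBasis
  refine ⟨{ b.det with cont := ?_ }, ?_⟩
  · have h : ∀ v : Fin n → Euc n, b.det v = Matrix.det (fun i j ↦ v j i) := fun v ↦ by
      rw [Module.Basis.det_apply]
      rfl
    change Continuous fun v ↦ b.det v
    simp only [h]
    exact Continuous.matrix_det (continuous_matrix fun i j ↦ by fun_prop)
  · have hb' : ⇑b = fun i ↦ EuclideanSpace.basisFun (Fin n) ℝ i := funext fun i ↦ by simp [b]
    have := b.det_self
    rw [hb'] at this
    exact this

/-- A top-degree form is a multiple of the determinant in the standard basis. -/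
theorem compContinuousLinearMap_basisFun {n : ℕ} (σ : Euc n [⋀^Fin n]→L[ℝ] ℝ)
    (L : Euc n →L[ℝ] Euc n) :
    σ.compContinuousLinearMap L (fun i ↦ EuclideanSpace.basisFun (Fin n) ℝ i) =
      L.det * σ (fun i ↦ EuclideanSpace.basisFun (Fin n) ℝ i) := by
  let b := (EuclideanSpace.basisFun (Fin n) ℝ).toBasis
  have h := DFunLike.congr_fun (σ.toAlternatingMap.eq_smul_basis_det b)
    (fun i ↦ L (b i))
  have h2 : b.det (fun i ↦ L (b i)) = L.det := by
    have := b.det_comp (L : Euc n →ₗ[ℝ] Euc n) b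
    rw [b.det_self, mul_one] at this
    exact this
  rw [AlternatingMap.smul_apply, h2, smul_eq_mul, mul_comm] at h
  have hb : ∀ i, b i = EuclideanSpace.basisFun (Fin n) ℝ i := fun i ↦ by simp [b]
  have hb' : ⇑b = fun i ↦ EuclideanSpace.basisFun (Fin n) ℝ i := funext hb
  rw [hb'] at h
  exact h

theorem apply_basisFun_ne_zero {n : ℕ} {σ : Euc n [⋀^Fin n]→L[ℝ] ℝ} (h : σ ≠ 0) :
    σ (fun i ↦ EuclideanSpace.basisFun (Fin n) ℝ i) ≠ 0 := by
  let b := (EuclideanSpace.basisFun (Fin n) ℝ).toBasis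
  have h1 : σ.toAlternatingMap ≠ 0 := fun h' ↦ h (by
    ext v; exact DFunLike.congr_fun h' v)
  have hb' : ⇑b = fun i ↦ EuclideanSpace.basisFun (Fin n) ℝ i := funext fun i ↦ by simp [b]
  have := (σ.toAlternatingMap.map_basis_ne_zero_iff b).2 h1
  rw [hb'] at this
  exact this

end Algebra

/-! ### Smooth dependence of pullbacks, and Stokes' theorem on a vector space -/

section Smooth

variable {E F : Type*} [NormedAddCommGroup E] [NormedSpace ℝ E] [NormedAddCommGroup F]
  [NormedSpace ℝ F] {k : ℕ}

/-- Alternatization divided by `k!` is a continuous projection. It transfers smoothness from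
multilinear to alternating maps. -/
theorem exists_retraction_toContinuousMultilinearMap :
    ∃ P : ContinuousMultilinearMap ℝ (fun _ : Fin k ↦ E) ℝ →L[ℝ] E [⋀^Fin k]→L[ℝ] ℝ,
      ∀ θ : E [⋀^Fin k]→L[ℝ] ℝ, P θ.toContinuousMultilinearMap = θ := by
  let A : ContinuousMultilinearMap ℝ (fun _ : Fin k ↦ E) ℝ →ₗ[ℝ] E [⋀^Fin k]→L[ℝ] ℝ :=
    { toFun := fun f ↦ ContinuousMultilinearMap.alternatization f
      map_add' := fun f g ↦ by simp
      map_smul' := fun r f ↦ by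
        ext v
        simp only [ContinuousMultilinearMap.alternatization_apply_apply,
          ContinuousAlternatingMap.smul_apply, RingHom.id_apply, Finset.smul_sum]
        exact Finset.sum_congr rfl fun σ _ ↦ smul_comm _ _ _ }
  have hA : ∀ f, ‖A f‖ ≤ k.factorial * ‖f‖ := by
    intro f
    refine ContinuousAlternatingMap.opNorm_le_bound _ (by positivity) fun v ↦ ?_
    change ‖ContinuousMultilinearMap.alternatization f v‖ ≤ _
    rw [ContinuousMultilinearMap.alternatization_apply_apply]
    refine (norm_sum_le _ _).trans ?_
    have : ∀ σ ∈ (Finset.univ : Finset (Equiv.Perm (Fin k))),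
        ‖Equiv.Perm.sign σ • f (v ∘ σ)‖ ≤ ‖f‖ * ∏ i, ‖v i‖ := by
      intro σ _
      have h1 : ‖Equiv.Perm.sign σ • f (v ∘ σ)‖ = ‖f (v ∘ σ)‖ := by
        rcases Int.units_eq_one_or (Equiv.Perm.sign σ) with h | h <;> simp [h]
      rw [h1]
      refine (f.le_opNorm _).trans_eq ?_
      congr 1
      exact Equiv.prod_comp σ (fun i ↦ ‖v i‖)
    refine (Finset.sum_le_card_nsmul _ _ _ this).trans_eq ?_
    simp [Fintype.card_perm, mul_assoc]
  refine ⟨((k.factorial : ℝ)⁻¹) • A.mkContinuous _ hA, fun θ ↦ ?_⟩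
  ext v
  have h1 := DFunLike.congr_fun (AlternatingMap.coe_alternatization θ.toAlternatingMap) v
  have h2 : ContinuousMultilinearMap.alternatization θ.toContinuousMultilinearMap v =
      (k.factorial : ℝ) * θ v := by
    rw [ContinuousMultilinearMap.alternatization_apply_apply]
    rw [MultilinearMap.alternatization_apply] at h1
    simpa using! h1
  change (k.factorial : ℝ)⁻¹ * ContinuousMultilinearMap.alternatization
    θ.toContinuousMultilinearMap v = θ v
  rw [h2, inv_mul_cancel_left₀ (by positivity)]

/-- Pullback by `L` is the value on the diagonal of a map multilinear in one copy of `L` for each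
slot. -/
theorem contDiff_compContinuousLinearMap {r : WithTop ℕ∞} (θ : F [⋀^Fin k]→L[ℝ] ℝ) :
    ContDiff ℝ r (fun L : E →L[ℝ] F ↦ θ.compContinuousLinearMap L) := by
  obtain ⟨P, hP⟩ := exists_retraction_toContinuousMultilinearMap (E := E) (k := k)
  have h1 : ContDiff ℝ r (fun L : E →L[ℝ] F ↦
      ContinuousMultilinearMap.compContinuousLinearMapContinuousMultilinear ℝ
        (fun _ : Fin k ↦ E) (fun _ : Fin k ↦ F) ℝ (fun _ ↦ L)) :=
    (ContinuousMultilinearMap.contDiff _).comp (contDiff_pi.2 fun _ ↦ contDiff_id)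
  have h2 := P.contDiff.comp (h1.clm_apply (contDiff_const (c := θ.toContinuousMultilinearMap)))
  convert h2 using 1
  ext1 L
  exact (hP (θ.compContinuousLinearMap L)).symm

theorem extDeriv_fun_smul_of_differentiableAt {f : E → ℝ} {η : E → E [⋀^Fin k]→L[ℝ] ℝ} {x : E}
    (hf : DifferentiableAt ℝ f x) (hη : DifferentiableAt ℝ η x) :
    extDeriv (fun y ↦ f y • η y) x =
      f x • extDeriv η x + covectorWedge (fderiv ℝ f x) (η x) := by
  rw [extDeriv, fderiv_fun_smul hf hη, ContinuousAlternatingMap.alternatizeUncurryFin_add,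
    ContinuousAlternatingMap.alternatizeUncurryFin_smul]
  rfl

variable [FiniteDimensional ℝ E] [MeasurableSpace E] [BorelSpace E] {μ : Measure E}
  [μ.IsAddHaarMeasure]

/-- Integration by parts against the constant `1`. -/
theorem integral_fderiv_apply_eq_zero {f : E → ℝ} (hf : ContDiff ℝ 1 f) (hc : HasCompactSupport f)
    (v : E) : ∫ y, fderiv ℝ f y v ∂μ = 0 := by
  have hc' : HasCompactSupport (fun y ↦ fderiv ℝ f y v) := hc.fderiv_apply ℝ v
  have h1 : Continuous (fun y ↦ fderiv ℝ f y v) :=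
    (hf.continuous_fderiv (by simp)).clm_apply continuous_const
  have := integral_mul_fderiv_eq_neg_fderiv_mul_of_integrable (μ := μ) (f := fun _ ↦ (1 : ℝ))
    (g := f) (v := v) (by simp) (by simpa using h1.integrable_of_hasCompactSupport hc')
    (by simpa using hf.continuous.integrable_of_hasCompactSupport hc) (by simp)
    (fun x _ ↦ hf.differentiable (by simp) x)
  simpa using this

/-- Stokes' theorem for compactly supported forms on a vector space. -/
theorem integral_extDeriv_apply_eq_zero {η : E → E [⋀^Fin k]→L[ℝ] ℝ} (hη : ContDiff ℝ 1 η)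
    (hc : HasCompactSupport η) (v : Fin (k + 1) → E) : ∫ y, extDeriv η y v ∂μ = 0 := by
  have hd : ∀ w : Fin k → E, ContDiff ℝ 1 (fun y ↦ η y w) := fun w ↦
    ((ContinuousAlternatingMap.apply ℝ E ℝ w).contDiff).comp hη
  have hcw : ∀ w : Fin k → E, HasCompactSupport (fun y ↦ η y w) := fun w ↦
    hc.comp_left (g := fun θ : E [⋀^Fin k]→L[ℝ] ℝ ↦ θ w) rfl
  have : ∀ y, extDeriv η y v = _ := fun y ↦ extDeriv_apply (hη.differentiable (by simp) y) v
  simp only [this]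
  rw [integral_finsetSum]
  · refine Finset.sum_eq_zero fun i _ ↦ ?_
    simp only [zsmul_eq_mul, Int.cast_pow, Int.cast_neg, Int.cast_one]
    rw [integral_const_mul, integral_fderiv_apply_eq_zero (hd _) (hcw _), mul_zero]
  · intro i _
    simp only [zsmul_eq_mul]
    exact ((((hd _).continuous_fderiv (by simp)).clm_apply continuous_const
      ).integrable_of_hasCompactSupport ((hcw _).fderiv_apply ℝ _)).const_mul _

end Smooth

/-! ### Coordinate expressions under change of chart -/

section Charts

variable {n : ℕ} {M : Type*} [TopologicalSpace M] [ChartedSpace (Euc n) M]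

/-- The coordinate change from the chart at `c` to the chart at `d`. -/
def transition (c d : M) : Euc n → Euc n := chartAt (Euc n) d ∘ (chartAt (Euc n) c).symm

/-- The domain of the coordinate change from the chart at `c` to the chart at `d`. -/
def overlap (c d : M) : Set (Euc n) :=
  (chartAt (Euc n) c).target ∩ (chartAt (Euc n) c).symm ⁻¹' (chartAt (Euc n) d).source

theorem isOpen_overlap (c d : M) : IsOpen (overlap (n := n) c d) :=
  (chartAt (Euc n) c).isOpen_inter_preimage_symm (chartAt (Euc n) d).open_source

theorem symm_transition {c d : M} {y : Euc n} (hy : y ∈ overlap c d) :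
    (chartAt (Euc n) d).symm (transition c d y) = (chartAt (Euc n) c).symm y :=
  (chartAt (Euc n) d).left_inv hy.2

theorem transition_mem_overlap {c d : M} {y : Euc n} (hy : y ∈ overlap c d) :
    transition c d y ∈ overlap d c :=
  ⟨(chartAt (Euc n) d).map_source hy.2, by
    rw [mem_preimage, symm_transition hy]
    exact (chartAt (Euc n) c).map_target hy.1⟩

theorem transition_transition {c d : M} {y : Euc n} (hy : y ∈ overlap c d) :
    transition d c (transition c d y) = y := by
  rw [transition, Function.comp_apply, symm_transition hy, (chartAt (Euc n) c).right_inv hy.1]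

theorem image_transition (c d : M) : transition c d '' overlap c d = overlap (n := n) d c := by
  ext y
  constructor
  · rintro ⟨z, hz, rfl⟩
    exact transition_mem_overlap hz
  · exact fun hy ↦ ⟨_, transition_mem_overlap hy, transition_transition hy⟩

theorem injOn_transition (c d : M) : InjOn (transition (n := n) c d) (overlap c d) := by
  intro y hy z hz h
  rw [← transition_transition hy, h, transition_transition hz]

theorem mem_overlap_chartAt {c : M} {y : Euc n} (hy : y ∈ (chartAt (Euc n) c).target) :
    y ∈ overlap c ((chartAt (Euc n) c).symm y) :=
  ⟨hy, mem_chart_source _ _⟩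

/-- The coordinate expression of a 1-form in the chart at `c`. -/
def OneForm.coord (α : OneForm n M) (c : M) (y : Euc n) : Euc n →L[ℝ] ℝ :=
  (α ((chartAt (Euc n) c).symm y)).comp
    (mfderiv (𝓡 n) (𝓡 n) (chartAt (Euc n) c).symm y : Euc n →L[ℝ] Euc n)

theorem inChart_wedge {k : ℕ} (α : OneForm n M) (θ : DiffForm n M k) (c : M) (y : Euc n) :
    (α.wedge θ).inChart (chartAt (Euc n) c) y =
      covectorWedge (α.coord c y) (θ.inChart (chartAt (Euc n) c) y) :=
  covectorWedge_comp (E := Euc n) (E' := Euc n) _ _ _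

variable [IsManifold (𝓡 n) ∞ M]

theorem contDiffOn_transition (c d : M) : ContDiffOn ℝ ∞ (transition (n := n) c d) (overlap c d) := by
  have := contDiffOn_ext_coord_change (n := ∞) (I := 𝓡 n) d c
  refine (this.congr fun y hy ↦ ?_).mono fun y hy ↦ ?_
  · simp [transition]
  · simpa [overlap, extChartAt] using! hy

theorem contDiffAt_transition {c d : M} {y : Euc n} (hy : y ∈ overlap c d) :
    ContDiffAt ℝ ∞ (transition (n := n) c d) y :=
  (contDiffOn_transition c d).contDiffAt ((isOpen_overlap c d).mem_nhds hy)

theorem mdifferentiableAt_chartAt_symm {c : M} {y : Euc n} (hy : y ∈ (chartAt (Euc n) c).target) :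
    MDifferentiableAt (𝓡 n) (𝓡 n) (chartAt (Euc n) c).symm y :=
  mdifferentiableAt_atlas_symm (chart_mem_atlas _ _) hy

theorem mdifferentiableAt_chartAt {c x : M} (hx : x ∈ (chartAt (Euc n) c).source) :
    MDifferentiableAt (𝓡 n) (𝓡 n) (chartAt (Euc n) c) x :=
  mdifferentiableAt_atlas (chart_mem_atlas _ _) hx

theorem mfderiv_chartAt_symm_eq_comp {c d : M} {y : Euc n} (hy : y ∈ overlap c d) :
    (mfderiv (𝓡 n) (𝓡 n) (chartAt (Euc n) c).symm y : Euc n →L[ℝ] Euc n) =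
      (mfderiv (𝓡 n) (𝓡 n) (chartAt (Euc n) d).symm (transition c d y) : Euc n →L[ℝ] Euc n).comp
        (fderiv ℝ (transition c d) y) := by
  have h1 : (chartAt (Euc n) d).symm ∘ transition c d =ᶠ[𝓝 y] (chartAt (Euc n) c).symm := by
    filter_upwards [(isOpen_overlap c d).mem_nhds hy] with z hz using symm_transition hz
  have h2 : MDifferentiableAt (𝓡 n) (𝓡 n) (transition c d) y :=
    ((contDiffAt_transition hy).differentiableAt (by simp)).mdifferentiableAt
  have h3 := mfderiv_comp y
    (mdifferentiableAt_chartAt_symm (transition_mem_overlap hy).1) h2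
  rw [h1.mfderiv_eq, mfderiv_eq_fderiv] at h3
  exact h3

theorem inChart_eq_comp {k : ℕ} (η : DiffForm n M k) {c d : M} {y : Euc n} (hy : y ∈ overlap c d) :
    η.inChart (chartAt (Euc n) c) y =
      (η.inChart (chartAt (Euc n) d) (transition c d y)).compContinuousLinearMap
        (fderiv ℝ (transition c d) y) := by
  have h := mfderiv_chartAt_symm_eq_comp hy
  have h' : (chartAt (Euc n) d).symm (transition c d y) = (chartAt (Euc n) c).symm y :=
    symm_transition hy
  -- The fibre containing the value of `η` depends on the point, so the equality of points is
  -- substituted rather than rewritten.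
  have key : ∀ x : M, x = (chartAt (Euc n) c).symm y →
      ((η ((chartAt (Euc n) c).symm y)) : Euc n [⋀^Fin k]→L[ℝ] ℝ).compContinuousLinearMap
        (mfderiv (𝓡 n) (𝓡 n) (chartAt (Euc n) c).symm y : Euc n →L[ℝ] Euc n) =
      ((η x : Euc n [⋀^Fin k]→L[ℝ] ℝ).compContinuousLinearMap
        (mfderiv (𝓡 n) (𝓡 n) (chartAt (Euc n) d).symm (transition c d y) :
          Euc n →L[ℝ] Euc n)).compContinuousLinearMap (fderiv ℝ (transition c d) y) := by
    rintro x rfl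
    rw [h]
    rfl
  exact key _ h'

theorem coord_eq_comp (α : OneForm n M) {c d : M} {y : Euc n} (hy : y ∈ overlap c d) :
    α.coord c y = (α.coord d (transition c d y)).comp (fderiv ℝ (transition c d) y) := by
  have h := mfderiv_chartAt_symm_eq_comp hy
  have h' : (chartAt (Euc n) d).symm (transition c d y) = (chartAt (Euc n) c).symm y :=
    symm_transition hy
  unfold OneForm.coord
  rw [h, h']
  rfl

/-- Continuity as a section of the bundle is read in the trivialization at `x`, giving continuity of
the coordinate expression at the centre of the chart at `x`. Any other point of the chart at `c` is
reached by the change to the chart centred there. -/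
theorem continuousOn_coord {α : OneForm n M} (hα : α.IsContinuous) (c : M) :
    ContinuousOn (α.coord c) (chartAt (Euc n) c).target := by
  have h0 : ∀ x : M, ContinuousAt (α.coord x) (chartAt (Euc n) x x) := by
    intro x
    have h1 := ((continuousAt_hom_bundle (RingHom.id ℝ) _).1 (Continuous.continuousAt (x := x) hα)).2
    have h2 : (fun z : M ↦ α.coord x (chartAt (Euc n) x z)) =ᶠ[𝓝 x]
        fun z ↦ ContinuousLinearMap.inCoordinates (Euc n) (TangentSpace (𝓡 n)) ℝ
          (Bundle.Trivial M ℝ) x z x z (α z) := by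
      filter_upwards [(chartAt (Euc n) x).open_source.mem_nhds (mem_chart_source _ x)] with z hz
      rw [ContinuousLinearMap.inCoordinates, TangentBundle.symmL_trivializationAt hz]
      have h3 : (chartAt (Euc n) x).symm (chartAt (Euc n) x z) = z :=
        (chartAt (Euc n) x).left_inv hz
      ext v
      simp only [OneForm.coord, extChartAt, mfld_simps]
      have key : ∀ w : M, w = z → ∀ D : Euc n →L[ℝ] Euc n,
          (α w : Euc n →L[ℝ] ℝ).comp D v = (α z : Euc n →L[ℝ] ℝ).comp D v := by
        rintro _ rfl D
        rfl
      simpa using! key _ h3 _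
    have h4 : ContinuousAt (fun z : M ↦ α.coord x (chartAt (Euc n) x z)) x :=
      h1.congr h2.symm
    have h5 : ContinuousAt (chartAt (Euc n) x).symm (chartAt (Euc n) x x) :=
      (chartAt (Euc n) x).continuousAt_symm (mem_chart_target _ x)
    have h6 : (chartAt (Euc n) x).symm (chartAt (Euc n) x x) = x :=
      (chartAt (Euc n) x).left_inv (mem_chart_source _ x)
    have h7 := ContinuousAt.comp (f := (chartAt (Euc n) x).symm)
      (g := fun z : M ↦ α.coord x (chartAt (Euc n) x z)) (by rwa [h6]) h5
    refine h7.congr ?_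
    filter_upwards [(chartAt (Euc n) x).open_target.mem_nhds (mem_chart_target _ x)] with z hz
    simp [(chartAt (Euc n) x).right_inv hz]
  intro y hy
  refine ContinuousAt.continuousWithinAt ?_
  set x := (chartAt (Euc n) c).symm y with hx
  have hyo : y ∈ overlap c x := mem_overlap_chartAt hy
  have h1 : ContinuousAt (fun z ↦ (α.coord x (transition c x z)).comp
      (fderiv ℝ (transition c x) z)) y := by
    refine ContinuousAt.clm_comp ?_ ?_
    · exact ContinuousAt.comp (f := transition c x) (g := α.coord x) (h0 x)
        (contDiffAt_transition hyo).continuousAt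
    · exact ((contDiffAt_transition hyo).fderiv_right (m := 0) (by simp)).continuousAt
  refine h1.congr ?_
  filter_upwards [(isOpen_overlap c x).mem_nhds hyo] with z hz using (coord_eq_comp α hz).symm

/-- `DiffForm.d` uses a different chart at each point; the choice does not matter because the
exterior derivative commutes with pullback by coordinate changes. -/
theorem inChart_d {k : ℕ} {η : DiffForm n M k} (hη : η.IsContDiff ∞) {c : M} {y : Euc n}
    (hy : y ∈ (chartAt (Euc n) c).target) :
    η.d.inChart (chartAt (Euc n) c) y = extDeriv (η.inChart (chartAt (Euc n) c)) y := by
  set x := (chartAt (Euc n) c).symm y with hx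
  have hyo : y ∈ overlap c x := mem_overlap_chartAt hy
  have h1 : η.inChart (chartAt (Euc n) c) =ᶠ[𝓝 y] fun z ↦
      (η.inChart (chartAt (Euc n) x) (transition c x z)).compContinuousLinearMap
        (fderiv ℝ (transition c x) z) := by
    filter_upwards [(isOpen_overlap c x).mem_nhds hyo] with z hz using inChart_eq_comp η hz
  have h2 : DifferentiableAt ℝ (η.inChart (chartAt (Euc n) x)) (transition c x y) :=
    ((hη x).contDiffAt ((chartAt (Euc n) x).open_target.mem_nhds
      (transition_mem_overlap hyo).1)).differentiableAt (by simp)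
  rw [h1.extDeriv_eq, extDeriv_pullback h2 (contDiffAt_transition hyo)
    (by rw [minSmoothness_of_isRCLikeNormedField]; exact WithTop.coe_le_coe.2 le_top)]
  have h3 : transition c x y = chartAt (Euc n) x x := rfl
  have h4 : fderiv ℝ (transition c x) y =
      (mfderiv (𝓡 n) (𝓡 n) (chartAt (Euc n) x) x : Euc n →L[ℝ] Euc n).comp
        (mfderiv (𝓡 n) (𝓡 n) (chartAt (Euc n) c).symm y : Euc n →L[ℝ] Euc n) := by
    rw [← mfderiv_eq_fderiv]
    exact mfderiv_comp y (mdifferentiableAt_chartAt (mem_chart_source _ x))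
      (mdifferentiableAt_chartAt_symm hy)
  rw [h4, h3]
  rfl

end Charts

/-! ### The integral of a top-degree form, computed in one chart -/

section Integral

variable {n : ℕ} {M : Type*} [TopologicalSpace M] [ChartedSpace (Euc n) M]

/-- The coefficient of `dx₁ ∧ … ∧ dxₙ` in the chart at `c`. -/
def DiffForm.coeff (μ : DiffForm n M n) (c : M) (y : Euc n) : ℝ :=
  μ.inChart (chartAt (Euc n) c) y (fun i ↦ EuclideanSpace.basisFun (Fin n) ℝ i)

theorem coeff_eq_zero {μ : DiffForm n M n} {c : M} {y : Euc n}
    (h : μ ((chartAt (Euc n) c).symm y) = 0) : μ.coeff c y = 0 := by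
  simp only [DiffForm.coeff, DiffForm.inChart, h]
  rfl

variable [IsManifold (𝓡 n) ∞ M]

theorem coeff_eq_det_mul (μ : DiffForm n M n) {c d : M} {y : Euc n} (hy : y ∈ overlap c d) :
    μ.coeff c y = (fderiv ℝ (transition c d) y).det * μ.coeff d (transition c d y) := by
  rw [DiffForm.coeff, inChart_eq_comp μ hy]
  exact compContinuousLinearMap_basisFun _ _

theorem coeff_form_ne_zero (o : OrientationForm n M) {c : M} {y : Euc n}
    (hy : y ∈ (chartAt (Euc n) c).target) : o.form.coeff c y ≠ 0 := by
  refine apply_basisFun_ne_zero fun h ↦ o.ne_zero ((chartAt (Euc n) c).symm y) ?_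
  have hs := (mdifferentiable_chart (I := 𝓡 n) c).symm.mfderiv_surjective hy
  ext v
  choose w hw using fun i ↦ hs (v i)
  have h1 := DFunLike.congr_fun h w
  have h2 : v = fun i ↦ mfderiv (𝓡 n) (𝓡 n) (chartAt (Euc n) c).symm y (w i) :=
    funext fun i ↦ (hw i).symm
  rw [h2]
  exact h1

/-- The orientation form and `μ` acquire the same Jacobian determinant. The sign of the former turns
the determinant of the latter into its absolute value, the factor in the change of variables
formula. -/
theorem chartSign_mul_coeff (o : OrientationForm n M) (μ : DiffForm n M n) {c d : M} {y : Euc n}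
    (hy : y ∈ overlap c d) :
    o.chartSign (chartAt (Euc n) c) y * μ.coeff c y =
      |(fderiv ℝ (transition c d) y).det| *
        (o.chartSign (chartAt (Euc n) d) (transition c d y) * μ.coeff d (transition c d y)) := by
  have h1 : o.chartSign (chartAt (Euc n) c) y = Real.sign (o.form.coeff c y) := rfl
  have h2 : o.chartSign (chartAt (Euc n) d) (transition c d y) =
      Real.sign (o.form.coeff d (transition c d y)) := rfl
  rw [h1, h2, coeff_eq_det_mul o.form hy, coeff_eq_det_mul μ hy]
  set D := (fderiv ℝ (transition c d) y).det
  set A := o.form.coeff d (transition c d y)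
  rcases lt_trichotomy D 0 with hD | hD | hD
  · rcases lt_trichotomy A 0 with hA | hA | hA
    · rw [Real.sign_of_pos (mul_pos_of_neg_of_neg hD hA), Real.sign_of_neg hA, abs_of_neg hD]; ring
    · simp [hA]
    · rw [Real.sign_of_neg (mul_neg_of_neg_of_pos hD hA), Real.sign_of_pos hA, abs_of_neg hD]; ring
  · simp [hD]
  · rcases lt_trichotomy A 0 with hA | hA | hA
    · rw [Real.sign_of_neg (mul_neg_of_pos_of_neg hD hA), Real.sign_of_neg hA, abs_of_pos hD]; ring
    · simp [hA]
    · rw [Real.sign_of_pos (mul_pos hD hA), Real.sign_of_pos hA, abs_of_pos hD]; ring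

/-- The coefficient of the orientation form is continuous without zeros, so it cannot change sign on
a connected set. -/
theorem exists_chartSign_eq (o : OrientationForm n M) {c : M} {s : Set (Euc n)}
    (hs : s ⊆ (chartAt (Euc n) c).target) (hsc : IsPreconnected s) :
    ∃ r : ℝ, r ≠ 0 ∧ ∀ y ∈ s, o.chartSign (chartAt (Euc n) c) y = r := by
  have hc : ContinuousOn (o.form.coeff c) s := by
    have h1 := ((o.continuous_form c).continuousOn).mono hs
    exact (ContinuousAlternatingMap.apply ℝ (Euc n) ℝ
      (fun i ↦ EuclideanSpace.basisFun (Fin n) ℝ i)).continuous.comp_continuousOn h1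
  rcases s.eq_empty_or_nonempty with rfl | ⟨x, hx⟩
  · exact ⟨1, one_ne_zero, fun y hy ↦ absurd hy (notMem_empty y)⟩
  have h0 : ∀ y ∈ s, o.form.coeff c y ≠ 0 := fun y hy ↦ coeff_form_ne_zero o (hs hy)
  have hsame : ∀ y ∈ s, 0 < o.form.coeff c x * o.form.coeff c y := by
    intro y hy
    by_contra! hle
    have hne := mul_ne_zero (h0 x hx) (h0 y hy)
    rcases mul_neg_iff.1 (lt_of_le_of_ne hle hne) with ⟨ha, hb⟩ | ⟨ha, hb⟩
    · obtain ⟨z, hz, hz0⟩ := hsc.intermediate_value hy hx hc ⟨hb.le, ha.le⟩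
      exact h0 z hz hz0
    · obtain ⟨z, hz, hz0⟩ := hsc.intermediate_value hx hy hc ⟨ha.le, hb.le⟩
      exact h0 z hz hz0
  refine ⟨Real.sign (o.form.coeff c x), ?_, fun y hy ↦ ?_⟩
  · exact fun h ↦ h0 x hx (Real.sign_eq_zero_iff.1 h)
  · change Real.sign (o.form.coeff c y) = Real.sign (o.form.coeff c x)
    rcases mul_pos_iff.1 (hsame y hy) with ⟨ha, hb⟩ | ⟨ha, hb⟩
    · rw [Real.sign_of_pos ha, Real.sign_of_pos hb]
    · rw [Real.sign_of_neg ha, Real.sign_of_neg hb]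

/-- The local integrals that define the integral of a form are independent of the chart. -/
theorem setIntegral_chart_eq (o : OrientationForm n M) (μ : DiffForm n M n) (ρ : M → ℝ) (c d : M)
    (hρ : ∀ x ∉ (chartAt (Euc n) c).source, ρ x = 0)
    (hμ : ∀ x ∉ (chartAt (Euc n) d).source, μ x = 0) :
    ∫ y in (chartAt (Euc n) c).target, ρ ((chartAt (Euc n) c).symm y) *
        (o.chartSign (chartAt (Euc n) c) y * μ.coeff c y) =
      ∫ y in (chartAt (Euc n) d).target, ρ ((chartAt (Euc n) d).symm y) *
        (o.chartSign (chartAt (Euc n) d) y * μ.coeff d y) := by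
  -- Off the overlap the left integrand vanishes because of `μ`, the right one because of `ρ`; on
  -- the overlap this is a change of variables.
  rw [setIntegral_eq_of_subset_of_forall_sdiff_eq_zero (s := overlap c d)
      (chartAt (Euc n) c).open_target.measurableSet (fun y hy ↦ hy.1),
    setIntegral_eq_of_subset_of_forall_sdiff_eq_zero (s := overlap d c)
      (chartAt (Euc n) d).open_target.measurableSet (fun y hy ↦ hy.1),
    ← image_transition c d,
    integral_image_eq_integral_abs_det_fderiv_smul volume (isOpen_overlap c d).measurableSet
      (fun y hy ↦ ((contDiffAt_transition hy).differentiableAt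
        (by simp)).hasFDerivAt.hasFDerivWithinAt) (injOn_transition c d)]
  · refine setIntegral_congr_fun (isOpen_overlap c d).measurableSet fun y hy ↦ ?_
    simp only [smul_eq_mul]
    rw [chartSign_mul_coeff o μ hy, symm_transition hy]
    ring
  · intro y hy
    rw [hρ _ fun h ↦ hy.2 ⟨hy.1, h⟩, zero_mul]
  · intro y hy
    rw [coeff_eq_zero (hμ _ fun h ↦ hy.2 ⟨hy.1, h⟩), mul_zero, mul_zero]

variable [T2Space M] [CompactSpace M]

theorem isSubordinate_chartPartition :
    (chartPartition n M).IsSubordinate fun x ↦ (chartAt (Euc n) x).source :=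
  Classical.choose_spec (SmoothPartitionOfUnity.exists_isSubordinate_chartAt_source (𝓡 n) M)

omit [IsManifold (𝓡 n) ∞ M] [T2Space M] in
theorem finite_ne_zero_of_compactSpace {ι : Type*}
    (ρ : SmoothPartitionOfUnity ι (𝓡 n) M univ) : {i | ∃ x, ρ i x ≠ 0}.Finite :=
  ρ.locallyFinite.finite_nonempty_of_compact

/-- The integral of a form supported in a ball of a chart. -/
theorem integral_eq_of_support_subset (o : OrientationForm n M) {μ : DiffForm n M n} {d : M}
    {x : Euc n} {r : ℝ} (hB : ball x r ⊆ (chartAt (Euc n) d).target) {K : Set (Euc n)}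
    (hK : IsCompact K) (hKB : K ⊆ ball x r)
    (hμ : ∀ p ∉ (chartAt (Euc n) d).symm '' K, μ p = 0) (hc : ContinuousOn (μ.coeff d) (ball x r))
    {s : ℝ} (hs : ∀ y ∈ ball x r, o.chartSign (chartAt (Euc n) d) y = s) :
    o.integral rfl μ = s * ∫ y in ball x r, μ.coeff d y := by
  have hKT : K ⊆ (chartAt (Euc n) d).target := hKB.trans hB
  have hzero : ∀ y ∈ (chartAt (Euc n) d).target, y ∉ K → μ.coeff d y = 0 := by
    intro y hy hyK
    refine coeff_eq_zero (hμ _ ?_)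
    rintro ⟨z, hz, hzy⟩
    exact hyK ((chartAt (Euc n) d).symm.injOn (hKT hz) hy hzy ▸ hz)
  have hsource : ∀ p ∉ (chartAt (Euc n) d).source, μ p = 0 := by
    intro p hp
    refine hμ p ?_
    rintro ⟨z, hz, rfl⟩
    exact hp ((chartAt (Euc n) d).map_target (hKT hz))
  -- Every term of the defining sum is moved to the chart at `d`, where the partition functions add
  -- up to `1`.
  have h1 : ∀ c : M, ∫ y in (chartAt (Euc n) c).target,
      chartPartition n M c ((chartAt (Euc n) c).symm y) *
        (o.chartSign (chartAt (Euc n) c) y * μ.coeff c y) =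
      ∫ y in ball x r, s * (chartPartition n M c ((chartAt (Euc n) d).symm y) * μ.coeff d y) := by
    intro c
    rw [setIntegral_chart_eq o μ (chartPartition n M c) c d _ hsource]
    · rw [setIntegral_eq_of_subset_of_forall_sdiff_eq_zero
        (chartAt (Euc n) d).open_target.measurableSet hB]
      · refine setIntegral_congr_fun measurableSet_ball fun y hy ↦ ?_
        simp only [hs y hy]
        ring
      · intro y hy
        rw [hzero y hy.1 fun h ↦ hy.2 (hKB h), mul_zero, mul_zero]
    · intro p hp
      exact image_eq_zero_of_notMem_tsupport fun h ↦ hp (isSubordinate_chartPartition c h)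
  have h2 : o.integral rfl μ = ∑ᶠ c : M, ∫ y in ball x r,
      s * (chartPartition n M c ((chartAt (Euc n) d).symm y) * μ.coeff d y) :=
    finsum_congr h1
  have hfin := finite_ne_zero_of_compactSpace (chartPartition n M)
  rw [h2, finsum_eq_sum_of_support_subset (s := hfin.toFinset)]
  swap
  · intro c hc
    simp only [Finite.coe_toFinset, mem_ofPred_eq]
    by_contra! hne
    exact hc (by simp [hne])
  rw [← integral_finsetSum]
  · rw [← integral_const_mul]
    refine setIntegral_congr_fun measurableSet_ball fun y hy ↦ ?_
    rw [← Finset.mul_sum, ← Finset.sum_mul]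
    have h3 := (chartPartition n M).sum_eq_one (mem_univ ((chartAt (Euc n) d).symm y))
    rw [finsum_eq_sum_of_support_subset (s := hfin.toFinset)] at h3
    · rw [h3, one_mul]
    · intro c hc
      simp only [Finite.coe_toFinset, mem_ofPred_eq]
      exact ⟨_, hc⟩
  · intro c _
    have hcont : ContinuousOn (fun y ↦ s * (chartPartition n M c ((chartAt (Euc n) d).symm y) *
        μ.coeff d y)) (ball x r) := by
      refine continuousOn_const.mul (ContinuousOn.mul ?_ hc)
      exact (chartPartition n M c).contMDiff.continuous.comp_continuousOn
        ((chartAt (Euc n) d).continuousOn_symm.mono hB)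
    refine ((hcont.mono hKB).integrableOn_compact hK).of_forall_sdiff_eq_zero measurableSet_ball
      fun y hy ↦ ?_
    rw [hzero y (hB hy.1) hy.2, mul_zero, mul_zero]

end Integral

/-! ### Gluing local primitives on a topological ball -/

section Disk

variable {E : Type*} [NormedAddCommGroup E] [NormedSpace ℝ E]

/-- A locally constant function on a preconnected set is constant. -/
theorem eq_of_eventually_eq_of_isPreconnected {X Y : Type*} [TopologicalSpace X] {S : Set X}
    (hS : IsPreconnected S) {k : X → Y} (hk : ∀ x ∈ S, ∀ᶠ y in 𝓝[S] x, k y = k x) {x y : X}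
    (hx : x ∈ S) (hy : y ∈ S) : k x = k y := by
  have : PreconnectedSpace S := isPreconnected_iff_preconnectedSpace.1 hS
  have hloc : IsLocallyConstant (fun z : S ↦ k z) := by
    rw [IsLocallyConstant.iff_eventually_eq]
    intro z
    have := hk z z.2
    rw [nhdsWithin_eq_map_subtype_coe z.2] at this
    exact this
  exact hloc.apply_eq_of_preconnectedSpace ⟨x, hx⟩ ⟨y, hy⟩

/-- Only local constancy is available: `O ∩ O'` need not be connected. -/
theorem eventually_sub_eq_of_hasFDerivAt {β : E → E →L[ℝ] ℝ} {O O' : Set E} (hO : IsOpen O)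
    (hO' : IsOpen O') {g g' : E → ℝ} (hg : ∀ y ∈ O, HasFDerivAt g (β y) y)
    (hg' : ∀ y ∈ O', HasFDerivAt g' (β y) y) {x : E} (hx : x ∈ O) (hx' : x ∈ O') :
    ∀ᶠ y in 𝓝 x, g y - g' y = g x - g' x := by
  obtain ⟨r, hr, hrO⟩ := Metric.isOpen_iff.1 (hO.inter hO') x ⟨hx, hx'⟩
  have hd : ∀ y ∈ ball x r, HasFDerivAt (fun y ↦ g y - g' y) 0 y := fun y hy ↦ by
    simpa using! (hg y (hrO hy).1).sub (hg' y (hrO hy).2)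
  filter_upwards [ball_mem_nhds x hr] with y hy
  exact isOpen_ball.is_const_of_fderiv_eq_zero (𝕜 := ℝ) (convex_ball x r).isPreconnected
    (fun z hz ↦ (hd z hz).differentiableAt.differentiableWithinAt)
    (fun z hz ↦ (hd z hz).fderiv) hy (mem_ball_self hr)

/-- A locally exact 1-form on a topological ball is exact. -/
theorem exists_primitive_on_topological_ball {B : Set E} (h : B ≃ₜ closedBall (0 : E) 1)
    [ProperSpace E] {β : E → E →L[ℝ] ℝ}
    (hloc : ∀ z ∈ B, ∃ O, IsOpen O ∧ z ∈ O ∧ ∃ g : E → ℝ, ∀ y ∈ O, HasFDerivAt g (β y) y) :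
    ∃ U : E → ℝ, ∀ z ∈ B, ∃ O ∈ 𝓝 z, ∃ (g : E → ℝ) (C : ℝ),
      (∀ y ∈ O, HasFDerivAt g (β y) y) ∧ ∀ y ∈ O ∩ B, U y = g y + C := by
  classical
  choose! O hO hzO g hg using hloc
  have hcpt : CompactSpace (closedBall (0 : E) 1) :=
    isCompact_iff_compactSpace.1 (isCompact_closedBall _ _)
  -- A Lebesgue number of the cover transported to the round ball gives a uniform scale `δ` at which
  -- a single primitive `g (Y p)` serves around each `p`.
  obtain ⟨δ, hδ, hleb⟩ := lebesgue_number_lemma_of_metric (α := closedBall (0 : E) 1)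
    (s := univ) (c := fun z : B ↦ {p | (h.symm p : E) ∈ O z}) isCompact_univ
    (fun z ↦ (hO z z.2).preimage (continuous_subtype_val.comp h.symm.continuous))
    (fun p _ ↦ mem_iUnion.2 ⟨h.symm p, hzO _ (h.symm p).2⟩)
  choose Z hZ using fun p ↦ hleb p (mem_univ p)
  let H : E → E := fun p ↦ if hp : p ∈ closedBall (0 : E) 1 then (h.symm ⟨p, hp⟩ : E) else 0
  let Y : E → E := fun p ↦ if hp : p ∈ closedBall (0 : E) 1 then (Z ⟨p, hp⟩ : E) else 0
  have hH1 : ∀ p (hp : p ∈ closedBall (0 : E) 1), H p = h.symm ⟨p, hp⟩ := fun p hp ↦ dif_pos hp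
  have hY1 : ∀ p (hp : p ∈ closedBall (0 : E) 1), Y p = Z ⟨p, hp⟩ := fun p hp ↦ dif_pos hp
  have hH : ContinuousOn H (closedBall (0 : E) 1) := by
    rw [continuousOn_iff_continuous_domRestrict]
    convert continuous_subtype_val.comp h.symm.continuous using 1
    ext p
    exact hH1 p p.2
  have hY : ∀ p ∈ closedBall (0 : E) 1, Y p ∈ B := fun p hp ↦ hY1 p hp ▸ (Z ⟨p, hp⟩).2
  have hHO : ∀ p ∈ closedBall (0 : E) 1, ∀ q ∈ closedBall (0 : E) 1, dist q p < δ →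
      H q ∈ O (Y p) := by
    intro p hp q hq hqp
    have := hZ ⟨p, hp⟩ (show (⟨q, hq⟩ : closedBall (0 : E) 1) ∈ ball ⟨p, hp⟩ δ from hqp)
    rw [hH1 q hq, hY1 p hp]
    exact this
  -- Increments of the chosen primitives form a cocycle at scale `δ`. The primitives at `p` and at
  -- `q` differ by a locally constant function on an intersection of balls of the model; that set is
  -- convex, hence connected, whereas its image in `B` has no usable shape.
  have hw : ∀ p ∈ closedBall (0 : E) 1, ∀ q ∈ closedBall (0 : E) 1, ∀ r ∈ closedBall (0 : E) 1,
      dist p q < δ → dist q r < δ → dist p r < δ →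
      (g (Y p) (H q) - g (Y p) (H p)) + (g (Y q) (H r) - g (Y q) (H q)) =
        g (Y p) (H r) - g (Y p) (H p) := by
    intro p hp q hq r hr hpq hqr hpr
    have hS : IsPreconnected (closedBall (0 : E) 1 ∩ (ball p δ ∩ ball q δ)) :=
      ((convex_closedBall _ _).inter ((convex_ball _ _).inter (convex_ball _ _))).isPreconnected
    have := eq_of_eventually_eq_of_isPreconnected hS
      (k := fun x ↦ g (Y p) (H x) - g (Y q) (H x)) ?_ (x := q) (y := r)
      ⟨hq, by rwa [mem_ball, dist_comm], mem_ball_self hδ⟩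
      ⟨hr, by rwa [mem_ball, dist_comm], by rwa [mem_ball, dist_comm]⟩
    · linarith
    · intro x hx
      have h1 := eventually_sub_eq_of_hasFDerivAt (hO _ (hY p hp)) (hO _ (hY q hq))
        (hg _ (hY p hp)) (hg _ (hY q hq)) (hHO p hp x hx.1 hx.2.1) (hHO q hq x hx.1 hx.2.2)
      exact ((hH x hx.1).mono inter_subset_left).eventually h1
  obtain ⟨u, hu⟩ := exists_increment_of_local_cocycle (E := E)
    (w := fun p q ↦ g (Y p) (H q) - g (Y p) (H p)) hδ hw
  -- The potential is meaningful only on `B`, whose boundary may be irregular; hence the comparison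
  -- with `g` on `O ∩ B`, while `g` is differentiable on all of `O`.
  let U : E → ℝ := fun x ↦ if hx : x ∈ B then u (h ⟨x, hx⟩) else 0
  refine ⟨U, fun z hz ↦ ?_⟩
  set p : closedBall (0 : E) 1 := h ⟨z, hz⟩ with hp
  have hHh : ∀ y (hy : y ∈ B), H (h ⟨y, hy⟩) = y := fun y hy ↦ by
    rw [hH1 _ (h ⟨y, hy⟩).2, Subtype.coe_eta, h.symm_apply_apply]
  have hzO' : z ∈ O (Y p) := by
    have := hHO p p.2 p p.2 (by simpa)
    rwa [hp, hHh z hz, ← hp] at this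
  have hnear : ∀ᶠ y in 𝓝[B] z, ∀ hy : y ∈ B, dist (p : E) (h ⟨y, hy⟩) < δ / 2 := by
    rw [nhdsWithin_eq_map_subtype_coe hz, eventually_map]
    have h1 : ∀ᶠ y : B in 𝓝 ⟨z, hz⟩, dist (h y) p < δ / 2 :=
      (h.continuous.tendsto ⟨z, hz⟩).eventually (ball_mem_nhds p (half_pos hδ))
    filter_upwards [h1] with y hy hyB
    rw [dist_comm]
    exact hy
  rw [eventually_nhdsWithin_iff] at hnear
  refine ⟨O (Y p) ∩ {y | y ∈ B → ∀ hy : y ∈ B, dist (p : E) (h ⟨y, hy⟩) < δ / 2},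
    inter_mem ((hO _ (hY p p.2)).mem_nhds hzO') hnear, g (Y p), u p - g (Y p) z,
    fun y hy ↦ hg _ (hY p p.2) y hy.1, fun y hy ↦ ?_⟩
  have h1 := hu p p.2 (h ⟨y, hy.2⟩) (h ⟨y, hy.2⟩).2 (hy.1.2 hy.2 hy.2)
  rw [hHh y hy.2, show H p = z from hHh z hz] at h1
  simp only [U, hy.2, dif_pos]
  linarith

end Disk

/-! ### Fundamental theorem of calculus along a curve in the disk -/

section Curves

variable {E : Type*} [NormedAddCommGroup E] [NormedSpace ℝ E]

/-- The fundamental theorem of calculus along a `C¹` curve, for a locally exact form with a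
primitive defined on a set containing the curve. -/
theorem integral_along_eq_sub {B N : Set E} {β : E → E →L[ℝ] ℝ} {U : E → ℝ}
    (hU : ∀ z ∈ B, ∃ O ∈ 𝓝 z, ∃ (g : E → ℝ) (C : ℝ),
      (∀ y ∈ O, HasFDerivAt g (β y) y) ∧ ∀ y ∈ O ∩ B, U y = g y + C)
    (hβ : ContinuousOn β N) (hBN : B ⊆ N) {γ : ℝ → E} {a b : ℝ} (hab : a < b)
    (hγ : ContDiffOn ℝ 1 γ (Icc a b)) (hγB : ∀ t ∈ Icc a b, γ t ∈ B) {φ : ℝ → ℝ}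
    (hφ : ∀ t ∈ Ioo a b, φ t = β (γ t) (deriv γ t)) :
    IntervalIntegrable φ volume a b ∧ ∫ t in a..b, φ t = U (γ b) - U (γ a) := by
  -- The one-sided derivative is continuous up to the endpoints, where `deriv γ` may fail to be; the
  -- two agree inside, which suffices for the integral.
  have hcont : ContinuousOn (fun t ↦ β (γ t) (derivWithin γ (Icc a b) t)) (Icc a b) :=
    ((hβ.mono hBN).comp hγ.continuousOn hγB).clm_apply
      (hγ.continuousOn_derivWithin (uniqueDiffOn_Icc hab) (by simp))
  have hd : ∀ t ∈ Ioo a b, HasDerivAt γ (derivWithin γ (Icc a b) t) t := fun t ht ↦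
    ((hγ.differentiableOn (by simp)) t (Ioo_subset_Icc_self ht)).hasDerivWithinAt.hasDerivAt
      (Icc_mem_nhds ht.1 ht.2)
  have hφ' : EqOn (fun t ↦ β (γ t) (derivWithin γ (Icc a b) t)) φ (Ioo a b) := fun t ht ↦ by
    simp only
    rw [hφ t ht, (hd t ht).deriv]
  have hint : IntervalIntegrable (fun t ↦ β (γ t) (derivWithin γ (Icc a b) t)) volume a b :=
    hcont.intervalIntegrable_of_Icc hab.le
  constructor
  · rw [intervalIntegrable_iff_integrableOn_Ioo_of_le hab.le] at hint ⊢
    exact hint.congr_fun hφ' measurableSet_Ioo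
  · have h1 : ∫ t in a..b, φ t = ∫ t in a..b, β (γ t) (derivWithin γ (Icc a b) t) := by
      rw [intervalIntegral.integral_of_le hab.le, intervalIntegral.integral_of_le hab.le,
        integral_Ioc_eq_integral_Ioo, integral_Ioc_eq_integral_Ioo]
      exact (setIntegral_congr_fun measurableSet_Ioo hφ').symm
    rw [h1]
    -- `U` need not be differentiable in the plane, but along the curve, which stays in `B`, it
    -- coincides locally with a differentiable `g` plus a constant.
    have hloc : ∀ t ∈ Icc a b, ∃ (g : E → ℝ) (C : ℝ), HasFDerivAt g (β (γ t)) (γ t) ∧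
        ∀ᶠ s in 𝓝[Icc a b] t, U (γ s) = g (γ s) + C := by
      intro t ht
      obtain ⟨O, hO, g, C, hg, hUg⟩ := hU _ (hγB t ht)
      refine ⟨g, C, hg _ (mem_of_mem_nhds hO), ?_⟩
      filter_upwards [(hγ.continuousOn t ht) hO, self_mem_nhdsWithin] with s hs hs'
      exact hUg _ ⟨hs, hγB s hs'⟩
    refine intervalIntegral.integral_eq_sub_of_hasDerivAt_of_le (f := fun t ↦ U (γ t)) hab.le
      ?_ ?_ hint
    · intro t ht
      obtain ⟨g, C, hg, hev⟩ := hloc t ht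
      have h2 : ContinuousWithinAt (fun s ↦ g (γ s) + C) (Icc a b) t :=
        (ContinuousAt.comp_continuousWithinAt hg.continuousAt (hγ.continuousOn t ht)).add
          continuousWithinAt_const
      exact h2.congr_of_eventuallyEq hev (hev.self_of_nhdsWithin ht)
    · intro t ht
      obtain ⟨g, C, hg, hev⟩ := hloc t (Ioo_subset_Icc_self ht)
      rw [nhdsWithin_eq_nhds.2 (Icc_mem_nhds ht.1 ht.2)] at hev
      exact ((hg.comp_hasDerivAt t (hd t ht)).add_const C).congr_of_eventuallyEq hev

end Curves

/-! ### Locally exact forms are closed in the Stokes sense -/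

section Potentials

variable {n : ℕ} {M : Type*} [TopologicalSpace M] [ChartedSpace (Euc n) M]

/-- A 1-form is locally exact: in suitable coordinates around each point it has a primitive. -/
def OneForm.IsLocallyExact (α : OneForm n M) : Prop :=
  ∀ c : M, ∃ r > 0, ball (chartAt (Euc n) c c) r ⊆ (chartAt (Euc n) c).target ∧
    ∃ F : Euc n → ℝ, ∀ y ∈ ball (chartAt (Euc n) c c) r, HasFDerivAt F (α.coord c y) y

/-- The pullback of a 1-form to the plane. -/
def OneForm.pullback (α : OneForm n M) (f : Euc 2 → M) (y : Euc 2) : Euc 2 →L[ℝ] ℝ :=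
  (α (f y) : Euc n →L[ℝ] ℝ).comp (mfderiv (𝓡 2) (𝓡 n) f y : Euc 2 →L[ℝ] Euc n)

variable [IsManifold (𝓡 n) ∞ M]

theorem pullback_eq_coord_comp (α : OneForm n M) {f : Euc 2 → M} {c : M} {y : Euc 2}
    (hf : MDifferentiableAt (𝓡 2) (𝓡 n) f y) (hy : f y ∈ (chartAt (Euc n) c).source) :
    HasFDerivAt (chartAt (Euc n) c ∘ f) (fderiv ℝ (chartAt (Euc n) c ∘ f) y) y ∧
    α.pullback f y =
      (α.coord c (chartAt (Euc n) c (f y))).comp (fderiv ℝ (chartAt (Euc n) c ∘ f) y) := by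
  have h1 : MDifferentiableAt (𝓡 2) (𝓡 n) (chartAt (Euc n) c ∘ f) y :=
    (mdifferentiableAt_chartAt hy).comp y hf
  refine ⟨h1.differentiableAt.hasFDerivAt, ?_⟩
  have h2 : fderiv ℝ (chartAt (Euc n) c ∘ f) y =
      (mfderiv (𝓡 n) (𝓡 n) (chartAt (Euc n) c) (f y) : Euc n →L[ℝ] Euc n).comp
        (mfderiv (𝓡 2) (𝓡 n) f y : Euc 2 →L[ℝ] Euc n) := by
    rw [← mfderiv_eq_fderiv]
    exact mfderiv_comp y (mdifferentiableAt_chartAt hy) hf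
  have h3 : (mfderiv (𝓡 n) (𝓡 n) (chartAt (Euc n) c).symm (chartAt (Euc n) c (f y)) :
      Euc n →L[ℝ] Euc n).comp
      (mfderiv (𝓡 n) (𝓡 n) (chartAt (Euc n) c) (f y) : Euc n →L[ℝ] Euc n) =
      ContinuousLinearMap.id ℝ (Euc n) :=
    (mdifferentiable_chart (I := 𝓡 n) c).symm_comp_deriv hy
  have h4 : (chartAt (Euc n) c).symm (chartAt (Euc n) c (f y)) = f y :=
    (chartAt (Euc n) c).left_inv hy
  have key : ∀ w : M, w = f y → ∀ D : Euc n →L[ℝ] Euc n,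
      (α w : Euc n →L[ℝ] ℝ).comp D = (α (f y) : Euc n →L[ℝ] ℝ).comp D := by
    rintro _ rfl D
    rfl
  have key2 : ∀ (a : Euc n →L[ℝ] ℝ) (S T : Euc n →L[ℝ] Euc n) (D : Euc 2 →L[ℝ] Euc n),
      S.comp T = ContinuousLinearMap.id ℝ (Euc n) → a.comp D = (a.comp S).comp (T.comp D) := by
    intro a S T D hST
    ext v
    exact congrArg a (DFunLike.congr_fun hST (D v)).symm
  rw [h2]
  refine (key2 (α (f y)) _ _ (mfderiv (𝓡 2) (𝓡 n) f y) h3).trans ?_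
  exact congrArg (fun a : Euc n →L[ℝ] ℝ ↦ a.comp _) (key _ h4 _).symm

theorem continuousOn_pullback {α : OneForm n M} (hα : α.IsContinuous) {f : Euc 2 → M}
    {N : Set (Euc 2)} (hN : IsOpen N) (hf : ContMDiffOn (𝓡 2) (𝓡 n) 1 f N) :
    ContinuousOn (α.pullback f) N := by
  intro z hz
  refine ContinuousAt.continuousWithinAt ?_
  have hfz : ContMDiffAt (𝓡 2) (𝓡 n) 1 f z := hf.contMDiffAt (hN.mem_nhds hz)
  set c := f z with hc
  have hev : ∀ᶠ y in 𝓝 z, y ∈ N ∧ f y ∈ (chartAt (Euc n) c).source :=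
    (show ∀ᶠ y in 𝓝 z, y ∈ N from hN.mem_nhds hz).and (hfz.continuousAt.eventually
      ((chartAt (Euc n) c).open_source.mem_nhds (mem_chart_source _ c)))
  have hcd : ContDiffAt ℝ 1 (chartAt (Euc n) c ∘ f) z := by
    rw [← contMDiffAt_iff_contDiffAt]
    exact ContMDiffAt.comp z ((contMDiffOn_chart (I := 𝓡 n) (n := 1)).contMDiffAt
      ((chartAt (Euc n) c).open_source.mem_nhds (mem_chart_source _ c))) hfz
  have h1 : ContinuousAt (fun y ↦ (α.coord c (chartAt (Euc n) c (f y))).comp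
      (fderiv ℝ (chartAt (Euc n) c ∘ f) y)) z := by
    refine ContinuousAt.clm_comp ?_ (hcd.fderiv_right (m := 0) (by simp)).continuousAt
    exact ContinuousAt.comp (f := chartAt (Euc n) c ∘ f) (g := α.coord c)
      ((continuousOn_coord hα c).continuousAt
        ((chartAt (Euc n) c).open_target.mem_nhds (mem_chart_target _ c))) hcd.continuousAt
  refine h1.congr ?_
  filter_upwards [hev] with y hy
  exact (pullback_eq_coord_comp α ((hf.contMDiffAt (hN.mem_nhds hy.1)).mdifferentiableAt
    (by simp)) hy.2).2.symm

/-- A primitive pulls back under a `C¹` map by the chain rule, although the pulled-back form is in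
general only continuous. -/
theorem exists_primitive_pullback {α : OneForm n M} (hα : α.IsLocallyExact) {f : Euc 2 → M}
    {N : Set (Euc 2)} (hN : IsOpen N) (hf : ContMDiffOn (𝓡 2) (𝓡 n) 1 f N) {z : Euc 2}
    (hz : z ∈ N) :
    ∃ O, IsOpen O ∧ z ∈ O ∧ ∃ g : Euc 2 → ℝ, ∀ y ∈ O, HasFDerivAt g (α.pullback f y) y := by
  set c := f z with hc
  obtain ⟨r, hr, hrT, F, hF⟩ := hα c
  have hev : ∀ᶠ y in 𝓝 z, y ∈ N ∧ f y ∈ (chartAt (Euc n) c).source ∧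
      chartAt (Euc n) c (f y) ∈ ball (chartAt (Euc n) c c) r := by
    have hfz : ContinuousAt f z := (hf.contMDiffAt (hN.mem_nhds hz)).continuousAt
    refine (show ∀ᶠ y in 𝓝 z, y ∈ N from hN.mem_nhds hz).and ((hfz.eventually
      ((chartAt (Euc n) c).open_source.mem_nhds (mem_chart_source _ c))).and ?_)
    have h1 : ContinuousAt (chartAt (Euc n) c) (f z) :=
      (chartAt (Euc n) c).continuousAt (mem_chart_source _ c)
    exact (h1.comp hfz).eventually (ball_mem_nhds _ hr)
  obtain ⟨O, hOs, hO, hzO⟩ := _root_.eventually_nhds_iff.1 hev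
  refine ⟨O, hO, hzO, F ∘ (chartAt (Euc n) c ∘ f), fun y hy ↦ ?_⟩
  obtain ⟨h1, h2, h3⟩ := hOs y hy
  have h4 := pullback_eq_coord_comp α ((hf.contMDiffAt (hN.mem_nhds h1)).mdifferentiableAt
    (by simp)) h2
  rw [h4.2]
  exact (hF _ h3).comp y h4.1

/-- The pullback has a potential on the whole disk. The integrals over the pieces of the boundary
are its increments, and they telescope to zero because the curve closes up. -/
theorem isStokesClosed_of_isLocallyExact {α : OneForm n M} (hα : α.IsContinuous)
    (h : α.IsLocallyExact) : α.IsStokesClosed := by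
  intro D
  obtain ⟨e⟩ := D.isDisk
  have hcpt : IsCompact D.domain := by
    have : CompactSpace (closedBall (0 : Euc 2) 1) :=
      isCompact_iff_compactSpace.1 (isCompact_closedBall _ _)
    exact isCompact_iff_compactSpace.2 e.symm.compactSpace
  have hmem : ∀ s ∈ Icc (0 : ℝ) 1, D.boundary s ∈ D.domain := fun s hs ↦
    hcpt.isClosed.frontier_subset (D.image_boundary ▸ mem_image_of_mem _ hs)
  obtain ⟨U, hU⟩ := exists_primitive_on_topological_ball e fun z hz ↦
    exists_primitive_pullback h D.isOpen_nhd D.contMDiffOn (D.domain_subset hz)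
  obtain ⟨m, t, ht0, htm, ht⟩ := D.piecewiseC1
  have hmono : ∀ i ≤ m, ∀ j ≤ i, t j ≤ t i := by
    intro i
    induction i with
    | zero => intro _ j hj; rw [Nat.le_zero.1 hj]
    | succ i ih =>
      intro hi j hj
      rcases Nat.of_le_succ hj with h | h
      · exact (ih (by omega) j h).trans (ht i (by omega)).1.le
      · rw [h]
  have hsub : ∀ i < m, Icc (t i) (t (i + 1)) ⊆ Icc 0 1 := by
    intro i hi
    refine Icc_subset_Icc ?_ ?_
    · rw [← ht0]; exact hmono i hi.le 0 (Nat.zero_le _)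
    · rw [← htm]; exact hmono m le_rfl (i + 1) hi
  have hpiece : ∀ i < m, _ := fun i hi ↦
    integral_along_eq_sub hU (continuousOn_pullback hα D.isOpen_nhd D.contMDiffOn)
      D.domain_subset (ht i hi).1 (ht i hi).2.1 (fun s hs ↦ hmem s (hsub i hi hs))
      (φ := fun s ↦ α ((D.toFun ∘ D.boundary) s)
        (mfderiv 𝓘(ℝ, ℝ) (𝓡 n) (D.toFun ∘ D.boundary) s (1 : ℝ))) (by
      intro s hs
      have hd : DifferentiableAt ℝ D.boundary s :=
        (((ht i hi).2.1.differentiableOn (by simp)) s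
          (Ioo_subset_Icc_self hs)).differentiableAt (Icc_mem_nhds hs.1 hs.2)
      have hf : MDifferentiableAt (𝓡 2) (𝓡 n) D.toFun (D.boundary s) :=
        (D.contMDiffOn.contMDiffAt (D.isOpen_nhd.mem_nhds (D.domain_subset
          (hmem s (hsub i hi (Ioo_subset_Icc_self hs)))))).mdifferentiableAt (by simp)
      rw [mfderiv_comp s hf hd.mdifferentiableAt, mfderiv_eq_fderiv]
      rfl)
  have hsum := intervalIntegral.sum_integral_adjacent_intervals (μ := volume)
    fun i hi ↦ (hpiece i hi).1
  rw [ht0, htm] at hsum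
  rw [OneForm.curveIntegral, ← hsum,
    Finset.sum_congr rfl fun i hi ↦ (hpiece i (Finset.mem_range.1 hi)).2,
    Finset.sum_range_sub (fun i ↦ U (D.boundary (t i))), ht0, htm, D.closed, sub_self]

end Potentials

/-! ### Cutting a form into pieces and adding up the integrals -/

section FormOperations

variable {n : ℕ} {M : Type*} [TopologicalSpace M] [ChartedSpace (Euc n) M]

theorem inChart_smul {k : ℕ} (χ : M → ℝ) (η : DiffForm n M k)
    (e : OpenPartialHomeomorph M (Euc n)) (y : Euc n) :
    DiffForm.inChart (fun x ↦ χ x • η x) e y = χ (e.symm y) • η.inChart e y := rfl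

theorem d_eq_zero_of_eventually_eq_zero {k : ℕ} {η : DiffForm n M k} {p : M}
    (h : ∀ᶠ q in 𝓝 p, η q = 0) : η.d p = 0 := by
  have h1 : ContinuousAt (chartAt (Euc n) p).symm (chartAt (Euc n) p p) :=
    (chartAt (Euc n) p).continuousAt_symm (mem_chart_target _ p)
  have h2 : η.inChart (chartAt (Euc n) p) =ᶠ[𝓝 (chartAt (Euc n) p p)] fun _ ↦ 0 := by
    rw [ContinuousAt, (chartAt (Euc n) p).left_inv (mem_chart_source _ p)] at h1
    filter_upwards [h1.eventually h] with y hy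
    simp only [DiffForm.inChart, hy]
    rfl
  have h3 : extDeriv (η.inChart (chartAt (Euc n) p)) (chartAt (Euc n) p p) = 0 := by
    rw [h2.extDeriv_eq, extDeriv, fderiv_fun_const]
    exact (ContinuousAlternatingMap.alternatizeUncurryFinCLM ℝ (Euc n) ℝ).map_zero
  simp only [DiffForm.d, h3]
  rfl

theorem wedge_eq_zero {k : ℕ} (α : OneForm n M) {θ : DiffForm n M k} {p : M} (h : θ p = 0) :
    α.wedge θ p = 0 := by
  simp only [OneForm.wedge, h]
  exact (covectorWedgeLM (E := Euc n) (α p)).map_zero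

theorem extDeriv_finsetSum {E ι : Type*} [NormedAddCommGroup E] [NormedSpace ℝ E] {k : ℕ}
    {s : Finset ι} {θ : ι → E → E [⋀^Fin k]→L[ℝ] ℝ} {x : E}
    (h : ∀ i ∈ s, DifferentiableAt ℝ (θ i) x) :
    extDeriv (fun y ↦ ∑ i ∈ s, θ i y) x = ∑ i ∈ s, extDeriv (θ i) x := by
  rw [extDeriv, fderiv_fun_sum h]
  exact map_sum (ContinuousAlternatingMap.alternatizeUncurryFinCLM ℝ E ℝ) _ _

variable [IsManifold (𝓡 n) ∞ M]

theorem isContDiff_smul {k : ℕ} {χ : M → ℝ} (hχ : ContMDiff (𝓡 n) 𝓘(ℝ, ℝ) ∞ χ)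
    {η : DiffForm n M k} (hη : η.IsContDiff ∞) :
    DiffForm.IsContDiff ∞ (fun x ↦ χ x • η x : DiffForm n M k) := by
  intro c
  have h1 : ContDiffOn ℝ ∞ (χ ∘ (chartAt (Euc n) c).symm) (chartAt (Euc n) c).target := by
    rw [← contMDiffOn_iff_contDiffOn]
    exact hχ.comp_contMDiffOn contMDiffOn_chart_symm
  exact h1.smul (hη c)

omit [IsManifold (𝓡 n) ∞ M] in
theorem wedge_d_eq_sum {k : ℕ} (α : OneForm n M) {ι : Type*} (s : Finset ι) {η : DiffForm n M k}
    {θ : ι → DiffForm n M k} (hθ : ∀ i ∈ s, (θ i).IsContDiff ∞) (h : ∀ x, η x = ∑ i ∈ s, θ i x) :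
    α.wedge η.d = fun x ↦ ∑ i ∈ s, α.wedge (θ i).d x := by
  funext x
  have h1 : η.inChart (chartAt (Euc n) x) =
      fun y ↦ ∑ i ∈ s, (θ i).inChart (chartAt (Euc n) x) y := by
    funext y
    simp only [DiffForm.inChart, h]
    exact map_sum (ContinuousAlternatingMap.compContinuousLinearMapCLM (F := ℝ)
      (mfderiv (𝓡 n) (𝓡 n) (chartAt (Euc n) x).symm y : Euc n →L[ℝ] Euc n)) _ _
  have h2 : η.d x = ∑ i ∈ s, (θ i).d x := by
    simp only [DiffForm.d, h1]
    rw [extDeriv_finsetSum fun i hi ↦ ((hθ i hi x).contDiffAt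
      ((chartAt (Euc n) x).open_target.mem_nhds (mem_chart_target _ x))).differentiableAt (by simp)]
    exact map_sum (ContinuousAlternatingMap.compContinuousLinearMapCLM (F := ℝ)
      (mfderiv (𝓡 n) (𝓡 n) (chartAt (Euc n) x) x : Euc n →L[ℝ] Euc n)) _ _
  simp only [OneForm.wedge, h2]
  exact map_sum (covectorWedgeLM (E := Euc n) (α x)) _ _

theorem inChart_wedge_d {k : ℕ} (α : OneForm n M) {η : DiffForm n M k} (hη : η.IsContDiff ∞)
    {c : M} {y : Euc n} (hy : y ∈ (chartAt (Euc n) c).target) :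
    (α.wedge η.d).inChart (chartAt (Euc n) c) y =
      covectorWedge (α.coord c y) (extDeriv (η.inChart (chartAt (Euc n) c)) y) := by
  rw [inChart_wedge, inChart_d hη hy]

theorem contDiffOn_extDeriv {E : Type*} [NormedAddCommGroup E] [NormedSpace ℝ E] {k : ℕ}
    {θ : E → E [⋀^Fin k]→L[ℝ] ℝ} {T : Set E} (hT : IsOpen T) (hθ : ContDiffOn ℝ ∞ θ T) :
    ContDiffOn ℝ ∞ (extDeriv θ) T :=
  (ContinuousAlternatingMap.alternatizeUncurryFinCLM ℝ E ℝ).contDiff.comp_contDiffOn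
    (hθ.fderiv_of_isOpen hT (by simp))

theorem continuousOn_inChart_wedge_d {k : ℕ} {α : OneForm n M} (hα : α.IsContinuous)
    {η : DiffForm n M k} (hη : η.IsContDiff ∞) (c : M) (v : Fin (k + 1 + 1) → Euc n) :
    ContinuousOn (fun y ↦ (α.wedge η.d).inChart (chartAt (Euc n) c) y v)
      (chartAt (Euc n) c).target := by
  have h1 : ContinuousOn (fun y ↦ ∑ i : Fin (k + 1 + 1), (-1) ^ (i : ℕ) * (α.coord c y (v i) *
      extDeriv (η.inChart (chartAt (Euc n) c)) y (i.removeNth v))) (chartAt (Euc n) c).target := by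
    refine continuousOn_finsetSum _ fun i _ ↦ continuousOn_const.mul (ContinuousOn.mul ?_ ?_)
    · exact (continuousOn_coord hα c).clm_apply continuousOn_const
    · exact (ContinuousAlternatingMap.apply ℝ (Euc n) ℝ (i.removeNth v)).continuous.comp_continuousOn
        (contDiffOn_extDeriv (chartAt (Euc n) c).open_target (hη c)).continuousOn
  refine h1.congr fun y hy ↦ ?_
  simp only [inChart_wedge_d α hη hy, covectorWedge_apply]

theorem continuousOn_chartSign (o : OrientationForm n M) (c : M) :
    ContinuousOn (o.chartSign (chartAt (Euc n) c)) (chartAt (Euc n) c).target := by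
  intro y hy
  obtain ⟨r, hr, hrT⟩ := Metric.isOpen_iff.1 (chartAt (Euc n) c).open_target y hy
  obtain ⟨s, -, hs⟩ := exists_chartSign_eq o hrT (convex_ball y r).isPreconnected
  have : o.chartSign (chartAt (Euc n) c) =ᶠ[𝓝 y] fun _ ↦ s := by
    filter_upwards [ball_mem_nhds y hr] with z hz using hs z hz
  exact (continuousAt_const.congr this.symm).continuousWithinAt

variable [T2Space M] [CompactSpace M]

theorem integral_finsetSum_form (o : OrientationForm n M) {ι : Type*} (s : Finset ι)
    (μ : ι → DiffForm n M n)
    (hμ : ∀ i ∈ s, ∀ c, ContinuousOn ((μ i).coeff c) (chartAt (Euc n) c).target) :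
    o.integral rfl (fun x ↦ ∑ i ∈ s, μ i x : DiffForm n M n) = ∑ i ∈ s, o.integral rfl (μ i) := by
  have hfin := finite_ne_zero_of_compactSpace (chartPartition n M)
  have hsum : ∀ μ : DiffForm n M n, o.integral rfl μ = ∑ c ∈ hfin.toFinset,
      ∫ y in (chartAt (Euc n) c).target, chartPartition n M c ((chartAt (Euc n) c).symm y) *
        (o.chartSign (chartAt (Euc n) c) y * μ.coeff c y) := by
    intro μ
    refine finsum_eq_sum_of_support_subset _ fun c hc ↦ ?_
    simp only [Finite.coe_toFinset, mem_ofPred_eq]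
    by_contra! hne
    exact hc (by simp [hne])
  have hcoeff : ∀ c y, DiffForm.coeff (fun x ↦ ∑ i ∈ s, μ i x : DiffForm n M n) c y =
      ∑ i ∈ s, (μ i).coeff c y := by
    intro c y
    have h1 : DiffForm.inChart (fun x ↦ ∑ i ∈ s, μ i x : DiffForm n M n) (chartAt (Euc n) c) y =
        ∑ i ∈ s, (μ i).inChart (chartAt (Euc n) c) y :=
      map_sum (ContinuousAlternatingMap.compContinuousLinearMapCLM (F := ℝ)
        (mfderiv (𝓡 n) (𝓡 n) (chartAt (Euc n) c).symm y : Euc n →L[ℝ] Euc n)) _ _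
    rw [DiffForm.coeff, h1]
    exact map_sum (ContinuousAlternatingMap.apply ℝ (Euc n) ℝ
      (fun i ↦ EuclideanSpace.basisFun (Fin n) ℝ i)) _ _
  simp only [hsum, hcoeff]
  rw [Finset.sum_comm]
  refine Finset.sum_congr rfl fun c _ ↦ ?_
  rw [← integral_finsetSum]
  · simp only [Finset.mul_sum]
  · intro i hi
    -- Integrability over the open chart target comes from the compact support of the partition
    -- function.
    have hK : IsCompact (chartAt (Euc n) c '' tsupport (chartPartition n M c)) :=
      (isClosed_tsupport _).isCompact.image_of_continuousOn
        ((chartAt (Euc n) c).continuousOn.mono (isSubordinate_chartPartition c))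
    have hKT : chartAt (Euc n) c '' tsupport (chartPartition n M c) ⊆
        (chartAt (Euc n) c).target := by
      rintro _ ⟨x, hx, rfl⟩
      exact (chartAt (Euc n) c).map_source (isSubordinate_chartPartition c hx)
    have hcont : ContinuousOn (fun y ↦ chartPartition n M c ((chartAt (Euc n) c).symm y) *
        (o.chartSign (chartAt (Euc n) c) y * (μ i).coeff c y)) (chartAt (Euc n) c).target :=
      ((chartPartition n M c).contMDiff.continuous.comp_continuousOn
        (chartAt (Euc n) c).continuousOn_symm).mul ((continuousOn_chartSign o c).mul (hμ i hi c))
    refine ((hcont.mono hKT).integrableOn_compact hK).of_forall_sdiff_eq_zero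
      (chartAt (Euc n) c).open_target.measurableSet fun y hy ↦ ?_
    rw [image_eq_zero_of_notMem_tsupport (fun h ↦ hy.2 ⟨_, h, (chartAt (Euc n) c).right_inv hy.1⟩),
      zero_mul]

end FormOperations

/-! ### Locally exact forms are closed in the weak sense -/

section Exact

/-- Stokes' theorem for `dF ∧ dθ` with `F` of class `C¹` and `θ` compactly supported in a ball. -/
theorem integral_covectorWedge_extDeriv_eq_zero {E : Type*} [NormedAddCommGroup E]
    [NormedSpace ℝ E] [FiniteDimensional ℝ E] [MeasurableSpace E] [BorelSpace E] {μ : Measure E}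
    [μ.IsAddHaarMeasure] {k : ℕ} {B K : Set E} (hB : IsOpen B) (hK : IsCompact K) (hKB : K ⊆ B)
    {a : E → E →L[ℝ] ℝ} (ha : ContinuousOn a B) {F : E → ℝ} (hF : ∀ y ∈ B, HasFDerivAt F (a y) y)
    {θ : E → E [⋀^Fin k]→L[ℝ] ℝ} (hθ : ContDiffOn ℝ ∞ θ B) (hθK : ∀ y ∈ B, y ∉ K → θ y = 0)
    (v : Fin (k + 1 + 1) → E) : ∫ y in B, covectorWedge (a y) (extDeriv θ y) v ∂μ = 0 := by
  classical
  have hF1 : ContDiffOn ℝ 1 F B := by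
    rw [show (1 : WithTop ℕ∞) = 0 + 1 by simp, contDiffOn_succ_iff_fderiv_of_isOpen hB]
    refine ⟨fun y hy ↦ (hF y hy).differentiableAt.differentiableWithinAt, by simp, ?_⟩
    rw [contDiffOn_zero]
    exact ha.congr fun y hy ↦ (hF y hy).fderiv
  have hdθ : ∀ y ∈ B, y ∉ K → extDeriv θ y = 0 := by
    intro y hy hyK
    have : θ =ᶠ[𝓝 y] fun _ ↦ 0 := by
      filter_upwards [hB.mem_nhds hy, hK.isClosed.isOpen_compl.mem_nhds hyK] with z hz hz'
        using hθK z hz hz'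
    rw [this.extDeriv_eq, extDeriv, fderiv_fun_const]
    exact (ContinuousAlternatingMap.alternatizeUncurryFinCLM ℝ E ℝ).map_zero
  -- `W` is `F dθ` extended by zero. It is `C¹` with compact support, and `dW = dF ∧ dθ` on `B`
  -- because `d(dθ) = 0`.
  let W : E → E [⋀^Fin (k + 1)]→L[ℝ] ℝ := fun y ↦ if y ∈ B then F y • extDeriv θ y else 0
  have hWB : ∀ y ∈ B, W =ᶠ[𝓝 y] fun z ↦ F z • extDeriv θ z := by
    intro y hy
    filter_upwards [hB.mem_nhds hy] with z hz using if_pos hz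
  have hWK : ∀ y ∉ K, W y = 0 := by
    intro y hy
    by_cases hyB : y ∈ B
    · simp only [W, if_pos hyB, hdθ y hyB hy, smul_zero]
    · exact if_neg hyB
  have hW : ContDiff ℝ 1 W := by
    rw [contDiff_iff_contDiffAt]
    intro y
    by_cases hy : y ∈ B
    · exact (((hF1.smul ((contDiffOn_extDeriv hB hθ).of_le (by simp))).contDiffAt
        (hB.mem_nhds hy))).congr_of_eventuallyEq (hWB y hy)
    · have : W =ᶠ[𝓝 y] fun _ ↦ 0 := by
        filter_upwards [hK.isClosed.isOpen_compl.mem_nhds fun h ↦ hy (hKB h)] with z hz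
          using hWK z hz
      exact contDiffAt_const.congr_of_eventuallyEq this
  have hWc : HasCompactSupport W := HasCompactSupport.intro hK hWK
  have h0 := integral_extDeriv_apply_eq_zero (μ := μ) hW hWc v
  rw [← setIntegral_eq_integral_of_forall_compl_eq_zero (s := B)] at h0
  · rw [← h0]
    refine setIntegral_congr_fun hB.measurableSet fun y hy ↦ ?_
    have hd : DifferentiableAt ℝ (extDeriv θ) y :=
      ((contDiffOn_extDeriv hB hθ).contDiffAt (hB.mem_nhds hy)).differentiableAt (by simp)
    have hdd : extDeriv (extDeriv θ) y = 0 :=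
      extDeriv_extDeriv_apply (hθ.contDiffAt (hB.mem_nhds hy))
        (by rw [minSmoothness_of_isRCLikeNormedField]; exact WithTop.coe_le_coe.2 le_top)
    rw [(hWB y hy).extDeriv_eq,
      extDeriv_fun_smul_of_differentiableAt (hF y hy).differentiableAt hd, hdd, (hF y hy).fderiv]
    simp
  · intro y hy
    have : W =ᶠ[𝓝 y] fun _ ↦ 0 := by
      filter_upwards [hK.isClosed.isOpen_compl.mem_nhds fun h ↦ hy (hKB h)] with z hz
        using hWK z hz
    rw [this.extDeriv_eq, extDeriv, fderiv_fun_const]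
    exact DFunLike.congr_fun (ContinuousAlternatingMap.alternatizeUncurryFinCLM ℝ E ℝ).map_zero v

variable {n : ℕ} {M : Type*} [TopologicalSpace M] [ChartedSpace (Euc n) M]
  [IsManifold (𝓡 n) ∞ M] [T2Space M] [CompactSpace M]

/-- A partition of unity subordinate to the balls that carry primitives cuts `η` into pieces `χ c •
η`; each contributes zero by Stokes in a single chart. -/
theorem isWeaklyClosed_of_isLocallyExact (o : OrientationForm n M) {α : OneForm n M}
    (hα : α.IsContinuous) (h : α.IsLocallyExact) : α.IsWeaklyClosed o := by
  intro k hk η hη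
  subst hk
  choose r hr hrT F hF using h
  let U : M → Set M := fun c ↦ (chartAt (Euc (k + 1 + 1)) c).source ∩
    chartAt (Euc (k + 1 + 1)) c ⁻¹' ball (chartAt (Euc (k + 1 + 1)) c c) (r c)
  obtain ⟨χ, hχ⟩ := SmoothPartitionOfUnity.exists_isSubordinate (𝓡 (k + 1 + 1)) isClosed_univ U
    (fun c ↦ (chartAt (Euc (k + 1 + 1)) c).isOpen_inter_preimage isOpen_ball)
    (fun x _ ↦ mem_iUnion.2 ⟨x, mem_chart_source _ x, mem_ball_self (hr x)⟩)
  have hfin := finite_ne_zero_of_compactSpace χ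
  let θ : M → DiffForm (k + 1 + 1) M k := fun c x ↦ χ c x • η x
  have hθ : ∀ c, (θ c).IsContDiff ∞ := fun c ↦ isContDiff_smul (χ c).contMDiff hη
  have hsum : ∀ x, η x = ∑ c ∈ hfin.toFinset, θ c x := by
    intro x
    have h1 := χ.sum_eq_one (mem_univ x)
    rw [finsum_eq_sum_of_support_subset (s := hfin.toFinset)] at h1
    · simp only [θ]
      rw [← Finset.sum_smul, h1, one_smul]
    · intro c hc
      simp only [Finite.coe_toFinset, mem_ofPred_eq]
      exact ⟨_, hc⟩
  rw [wedge_d_eq_sum α hfin.toFinset (fun c _ ↦ hθ c) hsum,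
    integral_finsetSum_form o _ _ fun c _ d ↦ continuousOn_inChart_wedge_d hα (hθ c) d _]
  refine Finset.sum_eq_zero fun c _ ↦ ?_
  obtain ⟨s, -, hs⟩ := exists_chartSign_eq o (hrT c) (convex_ball _ _).isPreconnected
  have hK : IsCompact (chartAt (Euc (k + 1 + 1)) c '' tsupport (χ c)) :=
    (isClosed_tsupport _).isCompact.image_of_continuousOn
      ((chartAt (Euc (k + 1 + 1)) c).continuousOn.mono fun x hx ↦ (hχ c hx).1)
  have hKB : chartAt (Euc (k + 1 + 1)) c '' tsupport (χ c) ⊆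
      ball (chartAt (Euc (k + 1 + 1)) c c) (r c) := by
    rintro _ ⟨x, hx, rfl⟩
    exact (hχ c hx).2
  rw [integral_eq_of_support_subset o (hrT c) hK hKB ?_
    ((continuousOn_inChart_wedge_d hα (hθ c) c _).mono (hrT c)) hs]
  · have h1 := integral_covectorWedge_extDeriv_eq_zero (μ := volume) isOpen_ball hK hKB
      ((continuousOn_coord hα c).mono (hrT c)) (hF c) ((hθ c c).mono (hrT c)) (fun y hy hyK ↦ ?_)
      (fun i ↦ EuclideanSpace.basisFun (Fin (k + 1 + 1)) ℝ i)
    · refine mul_eq_zero_of_right _ (Eq.trans ?_ h1)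
      refine setIntegral_congr_fun measurableSet_ball fun y hy ↦ ?_
      rw [DiffForm.coeff, inChart_wedge_d α (hθ c) (hrT c hy)]
    · simp only [θ, inChart_smul]
      have h2 : χ c ((chartAt (Euc (k + 1 + 1)) c).symm y) = 0 :=
        image_eq_zero_of_notMem_tsupport fun h ↦
          hyK ⟨_, h, (chartAt (Euc (k + 1 + 1)) c).right_inv (hrT c hy)⟩
      rw [h2, zero_smul]
  · intro p hp
    refine wedge_eq_zero α (d_eq_zero_of_eventually_eq_zero ?_)
    have hp' : p ∉ tsupport (χ c) := fun h ↦
      hp ⟨_, mem_image_of_mem _ h, (chartAt (Euc (k + 1 + 1)) c).left_inv (hχ c h).1⟩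
    filter_upwards [(isClosed_tsupport (χ c)).isOpen_compl.mem_nhds hp'] with q hq
    simp only [θ]
    rw [image_eq_zero_of_notMem_tsupport hq, zero_smul]

end Exact

/-! ### From distributional closedness in charts to local exactness -/

section Criterion

/-- Convolution needs a form on the whole space, whereas a coordinate expression is controlled only
on the chart target; a cutoff bridges the gap. -/
theorem exists_continuous_eqOn_ball {E F : Type*} [NormedAddCommGroup E] [NormedSpace ℝ E]
    [FiniteDimensional ℝ E] [NormedAddCommGroup F] [NormedSpace ℝ F] {a : E → F} {x : E} {R : ℝ}
    (hR : 0 < R) (ha : ContinuousOn a (ball x R)) :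
    ∃ b : E → F, Continuous b ∧ EqOn b a (ball x (R / 2)) := by
  let χ : ContDiffBump x := ⟨R / 2, 3 * R / 4, by positivity, by linarith⟩
  refine ⟨fun y ↦ χ y • a y, continuous_iff_continuousAt.2 fun y ↦ ?_, fun y hy ↦ ?_⟩
  · by_cases hy : y ∈ ball x R
    · exact χ.continuous.continuousAt.smul (ha.continuousAt (isOpen_ball.mem_nhds hy))
    · have hy' : y ∉ tsupport χ := by
        rw [χ.tsupport_eq]
        intro h
        rw [mem_closedBall] at h
        rw [mem_ball] at hy
        have : χ.rOut = 3 * R / 4 := rfl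
        linarith
      have : (fun y ↦ χ y • a y) =ᶠ[𝓝 y] fun _ ↦ 0 := by
        filter_upwards [(isClosed_tsupport χ).isOpen_compl.mem_nhds hy'] with z hz
        rw [image_eq_zero_of_notMem_tsupport hz, zero_smul]
      exact continuousAt_const.congr this.symm
  · simp only
    rw [χ.one_of_mem_closedBall (ball_subset_closedBall hy), one_smul]

variable {n : ℕ} {M : Type*} [TopologicalSpace M] [ChartedSpace (Euc n) M]
  [IsManifold (𝓡 n) ∞ M]

/-- A continuous 1-form whose coordinate expressions are closed in the sense of distributions
is locally exact. -/
theorem isLocallyExact_of_distribution_closed {α : OneForm n M} (hα : α.IsContinuous)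
    (h : ∀ c : M, ∃ R > 0, ball (chartAt (Euc n) c c) R ⊆ (chartAt (Euc n) c).target ∧
      ∀ ψ : Euc n → ℝ, ContDiff ℝ ∞ ψ → HasCompactSupport ψ →
        tsupport ψ ⊆ ball (chartAt (Euc n) c c) R → ∀ u v,
          ∫ y, fderiv ℝ ψ y u * α.coord c y v = ∫ y, fderiv ℝ ψ y v * α.coord c y u) :
    α.IsLocallyExact := by
  intro c
  obtain ⟨R, hR, hRT, hψ⟩ := h c
  obtain ⟨b, hb, hbeq⟩ := exists_continuous_eqOn_ball hR ((continuousOn_coord hα c).mono hRT)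
  obtain ⟨F, hF⟩ := exists_primitive_of_distribution_closed (μ := volume) hb (half_pos hR)
    fun ψ h1 h2 h3 u v ↦ by
      have h4 : ∀ y u v, fderiv ℝ ψ y u * b y v = fderiv ℝ ψ y u * α.coord c y v := by
        intro y u v
        by_cases hy : y ∈ tsupport ψ
        · rw [hbeq (h3 hy)]
        · rw [image_eq_zero_of_notMem_tsupport fun h ↦ hy (tsupport_fderiv_subset ℝ h)]
          simp
      simp only [h4]
      exact hψ ψ h1 h2 (h3.trans (ball_subset_ball (by linarith))) u v
  -- The radius is halved once by the cutoff and once by the mollification.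
  refine ⟨R / 2 / 2, by positivity, (ball_subset_ball (by linarith)).trans hRT, F, fun y hy ↦ ?_⟩
  rw [← hbeq (ball_subset_ball (by linarith) hy)]
  exact hF y hy

end Criterion

/-! ### Weakly closed forms are locally exact -/

section Weak

variable {n : ℕ} {M : Type*} [TopologicalSpace M] [ChartedSpace (Euc n) M]

/-- The form on `M` that is `ψ • θ₀` in the chart at `c`, extended by zero. -/
def chartForm (n : ℕ) {M : Type*} [TopologicalSpace M] [ChartedSpace (Euc n) M] {k : ℕ} (c : M)
    (ψ : Euc n → ℝ) (θ₀ : Euc n [⋀^Fin k]→L[ℝ] ℝ) : DiffForm n M k := by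
  classical
  exact fun x ↦ if x ∈ (chartAt (Euc n) c).source then
    ψ (chartAt (Euc n) c x) • θ₀.compContinuousLinearMap
      (mfderiv (𝓡 n) (𝓡 n) (chartAt (Euc n) c) x) else 0

theorem chartForm_eq_zero {k : ℕ} {c : M} {ψ : Euc n → ℝ} {θ₀ : Euc n [⋀^Fin k]→L[ℝ] ℝ} {x : M}
    (hx : x ∉ (chartAt (Euc n) c).symm '' tsupport ψ) : chartForm n c ψ θ₀ x = 0 := by
  classical
  by_cases h : x ∈ (chartAt (Euc n) c).source
  · have h1 : ψ (chartAt (Euc n) c x) = 0 := image_eq_zero_of_notMem_tsupport fun h' ↦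
      hx ⟨_, h', (chartAt (Euc n) c).left_inv h⟩
    simp only [chartForm, if_pos h, h1, zero_smul]
  · simp only [chartForm, if_neg h]

variable [IsManifold (𝓡 n) ∞ M]

theorem inChart_chartForm {k : ℕ} {c : M} (ψ : Euc n → ℝ) (θ₀ : Euc n [⋀^Fin k]→L[ℝ] ℝ)
    {y : Euc n} (hy : y ∈ (chartAt (Euc n) c).target) :
    (chartForm n c ψ θ₀).inChart (chartAt (Euc n) c) y = ψ y • θ₀ := by
  classical
  have hs := (chartAt (Euc n) c).map_target hy
  have h1 : (mfderiv (𝓡 n) (𝓡 n) (chartAt (Euc n) c) ((chartAt (Euc n) c).symm y) :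
      Euc n →L[ℝ] Euc n).comp
      (mfderiv (𝓡 n) (𝓡 n) (chartAt (Euc n) c).symm y : Euc n →L[ℝ] Euc n) =
      ContinuousLinearMap.id ℝ (Euc n) :=
    (mdifferentiable_chart (I := 𝓡 n) c).comp_symm_deriv hy
  simp only [DiffForm.inChart, chartForm, if_pos hs, (chartAt (Euc n) c).right_inv hy]
  ext v
  exact congrArg (fun w ↦ ψ y * θ₀ w) (funext fun i ↦ DFunLike.congr_fun h1 (v i))

/-- Over the source of the chart at `c`, the expression in another chart is a pullback by a smooth
coordinate change. Elsewhere the form vanishes nearby, because its compact support is closed in the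
Hausdorff space `M`. -/
theorem isContDiff_chartForm [T2Space M] {k : ℕ} {c : M} {ψ : Euc n → ℝ} (hψ : ContDiff ℝ ∞ ψ)
    (hψc : HasCompactSupport ψ) (hψT : tsupport ψ ⊆ (chartAt (Euc n) c).target)
    (θ₀ : Euc n [⋀^Fin k]→L[ℝ] ℝ) : (chartForm n c ψ θ₀).IsContDiff ∞ := by
  intro d y hy
  refine ContDiffAt.contDiffWithinAt ?_
  by_cases hs : (chartAt (Euc n) d).symm y ∈ (chartAt (Euc n) c).source
  · have hyo : y ∈ overlap d c := ⟨hy, hs⟩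
    have h1 : (chartForm n c ψ θ₀).inChart (chartAt (Euc n) d) =ᶠ[𝓝 y] fun z ↦
        ψ (transition d c z) • θ₀.compContinuousLinearMap (fderiv ℝ (transition d c) z) := by
      filter_upwards [(isOpen_overlap d c).mem_nhds hyo] with z hz
      rw [inChart_eq_comp _ hz, inChart_chartForm _ _ (transition_mem_overlap hz).1]
      rfl
    refine ContDiffAt.congr_of_eventuallyEq ?_ h1
    have h2 : ContDiffAt ℝ ∞ (fderiv ℝ (transition d c)) y :=
      (contDiffAt_transition hyo).fderiv_right (by simp)
    exact (hψ.contDiffAt.comp y (contDiffAt_transition hyo)).smul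
      ((contDiff_compContinuousLinearMap θ₀).contDiffAt.comp y h2)
  · have hK : IsClosed ((chartAt (Euc n) c).symm '' tsupport ψ) :=
      (hψc.isCompact.image_of_continuousOn
        ((chartAt (Euc n) c).continuousOn_symm.mono hψT)).isClosed
    have hyK : (chartAt (Euc n) d).symm y ∈ ((chartAt (Euc n) c).symm '' tsupport ψ)ᶜ := by
      rintro ⟨z, hz, hzy⟩
      exact hs (hzy ▸ (chartAt (Euc n) c).map_target (hψT hz))
    have h1 : (chartForm n c ψ θ₀).inChart (chartAt (Euc n) d) =ᶠ[𝓝 y] fun _ ↦ 0 := by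
      have h2 := ((chartAt (Euc n) d).continuousAt_symm hy).eventually
        (hK.isOpen_compl.mem_nhds hyK)
      filter_upwards [h2] with z hz
      simp only [DiffForm.inChart, chartForm_eq_zero hz]
      rfl
    exact contDiffAt_const.congr_of_eventuallyEq h1

theorem isLocallyExact_of_isWeaklyClosed [T2Space M] [CompactSpace M] (o : OrientationForm n M)
    {α : OneForm n M} (hα : α.IsContinuous) (h : α.IsWeaklyClosed o) : α.IsLocallyExact := by
  refine isLocallyExact_of_distribution_closed hα fun c ↦ ?_
  obtain ⟨R, hR, hRT⟩ := Metric.isOpen_iff.1 (chartAt (Euc n) c).open_target _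
    (mem_chart_target _ c)
  refine ⟨R, hR, hRT, fun ψ hψ hψc hψs u v ↦ ?_⟩
  -- In dimension below two, `u` and `v` are proportional and the identity holds for any form.
  rcases Nat.lt_or_ge n 2 with hn | hn
  · obtain ⟨e, he⟩ := finrank_le_one_iff.1 (show Module.finrank ℝ (Euc n) ≤ 1 by
      rw [finrank_euclideanSpace_fin]; omega)
    obtain ⟨r, rfl⟩ := he u
    obtain ⟨s, rfl⟩ := he v
    congr 1 with y
    simp only [map_smul, smul_eq_mul]
    ring
  obtain ⟨k, rfl⟩ : ∃ k, n = k + 1 + 1 := ⟨n - 2, by omega⟩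
  obtain ⟨σ, hσ⟩ := exists_volume (k + 1 + 1)
  -- With this order of contraction, `a ∧ dψ ∧ θ₀` is `(dψ(u) a(v) - dψ(v) a(u)) • σ`.
  let θ₀ : Euc (k + 1 + 1) [⋀^Fin k]→L[ℝ] ℝ := (σ.curryLeft v).curryLeft u
  have hη := isContDiff_chartForm hψ hψc (hψs.trans hRT) θ₀
  set η : DiffForm (k + 1 + 1) M k := chartForm (k + 1 + 1) c ψ θ₀ with hηdef
  -- The orientation enters only as a nonzero constant factor on the ball, which is cancelled below.
  obtain ⟨s, hs0, hs⟩ := exists_chartSign_eq o hRT (convex_ball _ _).isPreconnected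
  have hcoeff : ∀ y ∈ ball (chartAt (Euc (k + 1 + 1)) c c) R, (α.wedge η.d).coeff c y =
      fderiv ℝ ψ y u * α.coord c y v - fderiv ℝ ψ y v * α.coord c y u := by
    intro y hy
    have h1 : η.inChart (chartAt (Euc (k + 1 + 1)) c) =ᶠ[𝓝 y] fun z ↦ ψ z • θ₀ := by
      filter_upwards [(chartAt (Euc (k + 1 + 1)) c).open_target.mem_nhds (hRT hy)] with z hz
        using inChart_chartForm ψ θ₀ hz
    have h2 : extDeriv (fun _ : Euc (k + 1 + 1) ↦ θ₀) y = 0 := by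
      rw [extDeriv, fderiv_fun_const]
      exact (ContinuousAlternatingMap.alternatizeUncurryFinCLM ℝ _ ℝ).map_zero
    rw [DiffForm.coeff, inChart_wedge_d α hη (hRT hy), h1.extDeriv_eq,
      extDeriv_fun_smul_of_differentiableAt (hψ.differentiable (by simp) y)
        (differentiableAt_const _), h2, smul_zero, zero_add,
      covectorWedge_covectorWedge_curryLeft (by simp) σ, ContinuousAlternatingMap.smul_apply, hσ]
    simp
  have h0 := h k rfl η hη
  rw [integral_eq_of_support_subset o hRT hψc.isCompact hψs ?_
    ((continuousOn_inChart_wedge_d hα hη c _).mono hRT) hs] at h0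
  · have h1 := (mul_eq_zero.1 h0).resolve_left hs0
    rw [setIntegral_congr_fun measurableSet_ball hcoeff,
      setIntegral_eq_integral_of_forall_compl_eq_zero] at h1
    · have hint : ∀ u v : Euc (k + 1 + 1),
          Integrable (fun y ↦ fderiv ℝ ψ y u * α.coord c y v) := by
        intro u v
        have hcont : ContinuousOn (fun y ↦ fderiv ℝ ψ y u * α.coord c y v) (tsupport ψ) :=
          (((hψ.continuous_fderiv (by simp)).clm_apply continuous_const).continuousOn).mul
            (((continuousOn_coord hα c).mono (hψs.trans hRT)).clm_apply continuousOn_const)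
        rw [← integrableOn_univ]
        refine (hcont.integrableOn_compact hψc.isCompact).of_forall_sdiff_eq_zero
          MeasurableSet.univ fun y hy ↦ ?_
        rw [image_eq_zero_of_notMem_tsupport fun h ↦ hy.2 (tsupport_fderiv_subset ℝ h)]
        simp
      rw [integral_sub (hint u v) (hint v u)] at h1
      exact sub_eq_zero.1 h1
    · intro y hy
      rw [image_eq_zero_of_notMem_tsupport fun h ↦ hy (hψs (tsupport_fderiv_subset ℝ h))]
      simp
  · intro p hp
    refine wedge_eq_zero α (d_eq_zero_of_eventually_eq_zero ?_)
    have hK : IsClosed ((chartAt (Euc (k + 1 + 1)) c).symm '' tsupport ψ) :=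
      (hψc.isCompact.image_of_continuousOn
        ((chartAt (Euc (k + 1 + 1)) c).continuousOn_symm.mono (hψs.trans hRT))).isClosed
    filter_upwards [hK.isOpen_compl.mem_nhds hp] with q hq using chartForm_eq_zero hq

end Weak

/-! ### Forms closed in the Stokes sense are locally exact -/

section Stokes

open Real

theorem hasDerivAt_ellipse {E : Type*} [NormedAddCommGroup E] [NormedSpace ℝ E] (v w : E)
    (t : ℝ) : HasDerivAt (ellipse v w) ((2 * π) • ellipseDir v w t) t := by
  have h0 : HasDerivAt (fun t : ℝ ↦ 2 * π * t) (2 * π) t := by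
    simpa using (hasDerivAt_id t).const_mul (2 * π)
  have h := (h0.cos.smul_const v).add (h0.sin.smul_const w)
  refine h.congr_deriv ?_
  simp only [ellipseDir, smul_add, smul_smul]
  congr 2 <;> ring

/-- The standard parametrization of the unit circle of `ℝ²`. -/
def unitCircle : ℝ → Euc 2 :=
  ellipse (EuclideanSpace.single 0 1) (EuclideanSpace.single 1 1)

theorem unitCircle_apply_zero (t : ℝ) : unitCircle t 0 = cos (2 * π * t) := by
  simp [unitCircle, ellipse]

theorem unitCircle_apply_one (t : ℝ) : unitCircle t 1 = sin (2 * π * t) := by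
  simp [unitCircle, ellipse]

theorem isPiecewiseC1_unitCircle : IsPiecewiseC1 unitCircle := by
  refine ⟨1, fun i ↦ i, by simp, by simp, fun i hi ↦ ?_⟩
  obtain rfl : i = 0 := by omega
  refine ⟨by simp, ?_, fun s hs h ↦ ?_⟩
  · refine ContDiff.contDiffOn ?_
    unfold unitCircle ellipse
    fun_prop
  · have h1 : derivWithin unitCircle (Icc ((0 : ℕ) : ℝ) ((0 + 1 : ℕ) : ℝ)) s = _ :=
      (hasDerivAt_ellipse (EuclideanSpace.single (0 : Fin 2) (1 : ℝ))
        (EuclideanSpace.single 1 1) s).hasDerivWithinAt.derivWithin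
        (uniqueDiffOn_Icc (by simp) s hs)
    rw [h1, smul_eq_zero_iff_right (by positivity)] at h
    have h2 : sin (2 * π * s) = 0 := by simpa [ellipseDir] using congrArg (fun p : Euc 2 ↦ p 0) h
    have h3 : cos (2 * π * s) = 0 := by simpa [ellipseDir] using congrArg (fun p : Euc 2 ↦ p 1) h
    simpa [h2, h3] using sin_sq_add_cos_sq (2 * π * s)

theorem injOn_unitCircle : InjOn unitCircle (Ico 0 1) := by
  intro s hs t ht h
  have h1 : cos (2 * π * s) = cos (2 * π * t) := by
    rw [← unitCircle_apply_zero, h, unitCircle_apply_zero]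
  have h2 : sin (2 * π * s) = sin (2 * π * t) := by
    rw [← unitCircle_apply_one, h, unitCircle_apply_one]
  obtain ⟨k, hk⟩ := Real.Angle.angle_eq_iff_two_pi_dvd_sub.1 (Real.Angle.cos_sin_inj h1 h2)
  have h3 : s - t = k := mul_left_cancel₀ (two_pi_pos.ne') (by rw [← hk]; ring)
  have h4 : (k : ℝ) < 1 := by linarith [hs.2, ht.1]
  have h5 : (-1 : ℝ) < k := by linarith [hs.1, ht.2]
  have h6 : k = 0 := by
    have : k < 1 := by exact_mod_cast h4
    have : -1 < k := by exact_mod_cast h5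
    omega
  rw [h6, Int.cast_zero] at h3
  linarith

theorem image_unitCircle : unitCircle '' Icc 0 1 = frontier (closedBall (0 : Euc 2) 1) := by
  rw [frontier_closedBall _ one_ne_zero]
  ext p
  rw [mem_sphere_zero_iff_norm, EuclideanSpace.norm_eq, Real.sqrt_eq_one, Fin.sum_univ_two]
  simp only [Real.norm_eq_abs, sq_abs]
  constructor
  · rintro ⟨t, -, rfl⟩
    rw [unitCircle_apply_zero, unitCircle_apply_one, cos_sq_add_sin_sq]
  · intro hp
    have hz : ‖(⟨p 0, p 1⟩ : ℂ)‖ = 1 := by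
      rw [Complex.norm_eq_sqrt_sq_add_sq, hp, Real.sqrt_one]
    set z : ℂ := ⟨p 0, p 1⟩ with hzdef
    have hc : cos z.arg = p 0 := by
      rw [Complex.cos_arg (norm_ne_zero_iff.1 (by rw [hz]; exact one_ne_zero)), hz, div_one]
    have hs : sin z.arg = p 1 := by rw [Complex.sin_arg, hz, div_one]
    have hπ := pi_pos
    have key : ∀ t : ℝ, cos (2 * π * t) = p 0 → sin (2 * π * t) = p 1 → unitCircle t = p := by
      intro t h0 h1
      ext i
      fin_cases i
      · exact (unitCircle_apply_zero t).trans h0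
      · exact (unitCircle_apply_one t).trans h1
    -- `Complex.arg` takes values in `(-π, π]`; negative arguments are shifted by one turn to land
    -- in `[0, 1]`.
    rcases le_or_gt 0 z.arg with h | h
    · have h1 : 2 * π * (z.arg / (2 * π)) = z.arg := by field_simp
      refine ⟨z.arg / (2 * π), ⟨by positivity, ?_⟩, key _ (by rw [h1, hc]) (by rw [h1, hs])⟩
      rw [div_le_one (by positivity)]
      linarith [Complex.arg_le_pi z]
    · have h1 : 2 * π * (z.arg / (2 * π) + 1) = z.arg + 2 * π := by field_simp
      have h2 : -1 ≤ z.arg / (2 * π) := by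
        rw [le_div_iff₀ (by positivity)]
        linarith [Complex.neg_pi_lt_arg z]
      have h3 : z.arg / (2 * π) ≤ 0 := div_nonpos_of_nonpos_of_nonneg h.le (by positivity)
      exact ⟨z.arg / (2 * π) + 1, ⟨by linarith, by linarith⟩,
        key _ (by rw [h1, cos_add_two_pi, hc]) (by rw [h1, sin_add_two_pi, hs])⟩

/-- The linear map `ℝ² → E` that takes the standard basis to `v, w`. -/
def pairMap {E : Type*} [NormedAddCommGroup E] [NormedSpace ℝ E] (v w : E) : Euc 2 →L[ℝ] E :=
  (EuclideanSpace.proj 0 : Euc 2 →L[ℝ] ℝ).smulRight v +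
    (EuclideanSpace.proj 1 : Euc 2 →L[ℝ] ℝ).smulRight w

theorem pairMap_apply {E : Type*} [NormedAddCommGroup E] [NormedSpace ℝ E] (v w : E)
    (p : Euc 2) : pairMap v w p = p 0 • v + p 1 • w := rfl

theorem pairMap_unitCircle {E : Type*} [NormedAddCommGroup E] [NormedSpace ℝ E] (v w : E)
    (t : ℝ) : pairMap v w (unitCircle t) = ellipse v w t := by
  rw [pairMap_apply, unitCircle_apply_zero, unitCircle_apply_one, ellipse]

theorem norm_pairMap_le {E : Type*} [NormedAddCommGroup E] [NormedSpace ℝ E] (v w : E)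
    (p : Euc 2) (hp : ‖p‖ ≤ 1) : ‖pairMap v w p‖ ≤ ‖v‖ + ‖w‖ := by
  rw [pairMap_apply]
  refine (norm_add_le _ _).trans (add_le_add ?_ ?_) <;> rw [norm_smul] <;>
    exact mul_le_of_le_one_left (norm_nonneg _) ((PiLp.norm_apply_le p _).trans hp)

theorem injective_pairMap {E : Type*} [NormedAddCommGroup E] [NormedSpace ℝ E] {v w : E}
    (h : LinearIndependent ℝ ![v, w]) : Function.Injective (pairMap v w) := by
  rw [injective_iff_map_eq_zero]
  intro p hp
  obtain ⟨h0, h1⟩ := LinearIndependent.pair_iff.1 h _ _ hp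
  ext i
  fin_cases i
  · exact h0
  · exact h1

variable {n : ℕ} {M : Type*} [TopologicalSpace M] [ChartedSpace (Euc n) M]
  [IsManifold (𝓡 n) ∞ M]

/-- The disk in `M` bounded by an ellipse in the chart at `c`. -/
def ellipticDisk (c : M) {y v w : Euc n} (h : LinearIndependent ℝ ![v, w])
    (hT : closedBall y (‖v‖ + ‖w‖) ⊆ (chartAt (Euc n) c).target) : ImmersedDisk n M where
  domain := closedBall 0 1
  isDisk := ⟨Homeomorph.refl _⟩
  boundary := unitCircle
  piecewiseC1 := isPiecewiseC1_unitCircle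
  closed := by simp [unitCircle, ellipse]
  simple := injOn_unitCircle
  image_boundary := image_unitCircle
  toFun := (chartAt (Euc n) c).symm ∘ fun p ↦ y + pairMap v w p
  nhd := (fun p ↦ y + pairMap v w p) ⁻¹' (chartAt (Euc n) c).target
  isOpen_nhd := (chartAt (Euc n) c).open_target.preimage (by fun_prop)
  domain_subset := fun p hp ↦ hT (by
    rw [mem_closedBall_iff_norm, add_sub_cancel_left]
    exact norm_pairMap_le v w p (by simpa using hp))
  contMDiffOn := by
    have h1 : ContMDiffOn (𝓡 n) (𝓡 n) 1 (chartAt (Euc n) c).symm (chartAt (Euc n) c).target :=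
      (contMDiffOn_chart_symm (n := ∞)).of_le (by simp)
    have h2 : ContDiff ℝ 1 fun p ↦ y + pairMap v w p := by fun_prop
    exact h1.comp h2.contMDiff.contMDiffOn fun p hp ↦ hp
  immersive := fun p hp ↦ by
    have h1 : HasFDerivAt (fun p ↦ y + pairMap v w p) (pairMap v w) p :=
      (pairMap v w).hasFDerivAt.const_add y
    rw [mfderiv_comp p (mdifferentiableAt_chartAt_symm hp)
      h1.differentiableAt.mdifferentiableAt, mfderiv_eq_fderiv, h1.fderiv]
    have h2 := (mdifferentiable_chart (I := 𝓡 n) c).symm.mfderiv_injective hp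
    have h3 := injective_pairMap h
    exact h2.comp h3

/-- The Stokes condition on one elliptic disk; the velocity is `2π` times `ellipseDir`, and this
constant factor cancels. -/
theorem integral_coord_ellipse_eq_zero {α : OneForm n M} (h : α.IsStokesClosed) (c : M)
    {y v w : Euc n} (hvw : LinearIndependent ℝ ![v, w])
    (hT : closedBall y (‖v‖ + ‖w‖) ⊆ (chartAt (Euc n) c).target) :
    ∫ t in (0 : ℝ)..1, α.coord c (y + ellipse v w t) (ellipseDir v w t) = 0 := by
  have h0 := h (ellipticDisk c hvw hT)
  have h1 : (ellipticDisk c hvw hT).toFun ∘ (ellipticDisk c hvw hT).boundary =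
      (chartAt (Euc n) c).symm ∘ fun t ↦ y + ellipse v w t :=
    funext fun t ↦ congrArg (fun z ↦ (chartAt (Euc n) c).symm (y + z)) (pairMap_unitCircle v w t)
  rw [h1, OneForm.curveIntegral] at h0
  have h2 : ∀ t : ℝ, α (((chartAt (Euc n) c).symm ∘ fun t ↦ y + ellipse v w t) t)
      (mfderiv 𝓘(ℝ, ℝ) (𝓡 n) ((chartAt (Euc n) c).symm ∘ fun t ↦ y + ellipse v w t) t (1 : ℝ)) =
      2 * π * α.coord c (y + ellipse v w t) (ellipseDir v w t) := by
    intro t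
    have h3 : HasDerivAt (fun t ↦ y + ellipse v w t) ((2 * π) • ellipseDir v w t) t :=
      (hasDerivAt_ellipse v w t).const_add y
    have hy : y + ellipse v w t ∈ (chartAt (Euc n) c).target := hT (by
      rw [mem_closedBall_iff_norm, add_sub_cancel_left]
      exact norm_ellipse_le v w t)
    rw [mfderiv_comp t (mdifferentiableAt_chartAt_symm hy)
      h3.differentiableAt.mdifferentiableAt, mfderiv_eq_fderiv]
    have h5 : fderiv ℝ (fun t ↦ y + ellipse v w t) t 1 = (2 * π) • ellipseDir v w t := by
      rw [fderiv_apply_one_eq_deriv, h3.deriv]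
    have h4 := (α.coord c (y + ellipse v w t)).map_smul (2 * π) (ellipseDir v w t)
    rw [smul_eq_mul] at h4
    rw [← h4, ← h5]
    rfl
  simp only [h2] at h0
  rw [intervalIntegral.integral_const_mul] at h0
  exact (mul_eq_zero.1 h0).resolve_left (by positivity)

theorem isLocallyExact_of_isStokesClosed {α : OneForm n M} (hα : α.IsContinuous)
    (h : α.IsStokesClosed) : α.IsLocallyExact := by
  refine isLocallyExact_of_distribution_closed hα fun c ↦ ?_
  obtain ⟨R, hR, hRT⟩ := Metric.isOpen_iff.1 (chartAt (Euc n) c).open_target _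
    (mem_chart_target _ c)
  obtain ⟨b, hb, hbeq⟩ := exists_continuous_eqOn_ball hR ((continuousOn_coord hα c).mono hRT)
  have hsub : ball (chartAt (Euc n) c c) (R / 2) ⊆ (chartAt (Euc n) c).target :=
    (ball_subset_ball (by linarith)).trans hRT
  refine ⟨R / 2, half_pos hR, hsub, fun ψ hψ hψc hψs u v ↦ ?_⟩
  -- The coordinate expression may be replaced by its continuous extension `b`, since they agree on
  -- the support of `ψ`.
  have h4 : ∀ y u v, fderiv ℝ ψ y u * α.coord c y v = fderiv ℝ ψ y u * b y v := by
    intro y u v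
    by_cases hy : y ∈ tsupport ψ
    · rw [hbeq (hψs hy)]
    · rw [image_eq_zero_of_notMem_tsupport fun h ↦ hy (tsupport_fderiv_subset ℝ h)]
      simp
  simp only [h4]
  refine distribution_closed_of_integral_ellipse_eq_zero hb (fun (y v w : Euc n) hvw hball ↦ ?_)
    hψ hψc hψs u v
  have hbt : ∀ t, b (y + ellipse v w t) = α.coord c (y + ellipse v w t) := fun t ↦
    hbeq (hball (by
      rw [mem_closedBall_iff_norm, add_sub_cancel_left]
      exact norm_ellipse_le v w t))
  simp only [hbt]
  exact integral_coord_ellipse_eq_zero h c hvw (hball.trans hsub)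

end Stokes

end ClosedForms

end

theorem mainTheorem7 (n : ℕ) (M : Type*) [TopologicalSpace M] [T2Space M] [CompactSpace M]
    [ChartedSpace (ClosedForms.Euc n) M] [IsManifold (𝓡 n) ∞ M]
    (o : ClosedForms.OrientationForm n M)
    (α : ClosedForms.OneForm n M) (hα : α.IsContinuous) :
    α.IsWeaklyClosed o ↔ α.IsStokesClosed :=
  ⟨fun h ↦ ClosedForms.isStokesClosed_of_isLocallyExact hα
      (ClosedForms.isLocallyExact_of_isWeaklyClosed o hα h),
    fun h ↦ ClosedForms.isWeaklyClosed_of_isLocallyExact o hα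
      (ClosedForms.isLocallyExact_of_isStokesClosed hα h)⟩
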